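/- **Theorem 2.1.** Let $\{X_{ki}\}_{k,i\ge 1}$ be a double array of independent, identically distributed real random variables on one probability space, with mean $0$, variance $1$ and finite fourth moment. Let $p=p(n)$ be positive-integer dimensions such that $p/n\to y\in(0,1)$ as $n\to\infty$. For each $n$ put $X_i=(X_{1i},\dots,X_{pi})^T\in\mathbb{R}^p$ for $1\le i\le n$, and let $$K_n=\frac{2}{n(n-1)}\sum_{1\le i<j\le n}\frac{(X_i-X_j)(X_i-X_j)^T}{\|X_i-X_j\|^2}$$ be the sample multivariate Kendall-$\tau$ matrix, where $\|\cdot\|$ is the Euclidean norm and a term with $X_i=X_j$ is read as the zero matrix. For a real symmetric $p\times p$ matrix $A$ with eigenvalues $\lambda_1,\dots,\lambda_p$ (counted with multiplicity), let $F^A(x)=\frac1p\,\#\{i:\lambda_i\le x\}$ be its empirical spectral distribution. Then, almost surely, $F^{\frac12 pK_n}$ converges weakly, as $n\to\infty$, to the Marčenko–Pastur distribution with ratio $y$ and variance parameter $\tfrac12$, that is, to the probability distribution on $\mathbb{R}$, supported on $[a,b]$, with density $$f_y(x)=\begin{cases}\dfrac{1}{\pi xy}\sqrt{(b-x)(x-a)},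 & a\le x\le b,\\[1ex] 0,&\text{otherwise,}\end{cases}\qquad a=\tfrac12(1-\sqrt y)^2,\quad b=\tfrac12(1+\sqrt y)^2 .$$ -/

import Mathlib

open MeasureTheory ProbabilityTheory Filter Topology

noncomputable section

/-- The sample multivariate Kendall-τ matrix of `n` observations `x 0, …, x (n-1)` in `ℝ^p`:
`K_n = 2 / (n (n - 1)) ∑_{i < j} (x i - x j) (x i - x j)ᵀ / ‖x i - x j‖²`, with the Euclidean norm.
A pair with `x i = x j` contributes the zero matrix. -/
def kendallTau {p n : ℕ} (x : Fin n → EuclideanSpace ℝ (Fin p)) :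
    Matrix (Fin p) (Fin p) ℝ :=
  (2 / ((n : ℝ) * ((n : ℝ) - 1))) •
    ∑ i : Fin n, ∑ j ∈ Finset.Ioi i,
      (1 / ‖x i - x j‖ ^ 2) • Matrix.vecMulVec (x i - x j).ofLp (x i - x j).ofLp

theorem kendallTau_isHermitian {p n : ℕ} (x : Fin n → EuclideanSpace ℝ (Fin p)) :
    (kendallTau x).IsHermitian := by
  apply Matrix.IsHermitian.ext
  intro a b
  simp [kendallTau, Matrix.sum_apply, Matrix.vecMulVec_apply, mul_comm]

/-- The matrix `½ p K_n`. -/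
def scaledKendallTau {p n : ℕ} (x : Fin n → EuclideanSpace ℝ (Fin p)) :
    Matrix (Fin p) (Fin p) ℝ :=
  ((1 / 2 : ℝ) * (p : ℝ)) • kendallTau x

theorem scaledKendallTau_isHermitian {p n : ℕ} (x : Fin n → EuclideanSpace ℝ (Fin p)) :
    (scaledKendallTau x).IsHermitian := by
  have h := kendallTau_isHermitian x
  unfold Matrix.IsHermitian at h ⊢
  rw [scaledKendallTau, Matrix.conjTranspose_smul, h, star_trivial]

/-- The empirical spectral distribution of a real symmetric `p × p` matrix, as a distribution
function: `F^A(t) = (1 / p) · #{i : λ_i ≤ t}`, eigenvalues counted with multiplicity. -/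
def esd {p : ℕ} {A : Matrix (Fin p) (Fin p) ℝ} (hA : A.IsHermitian) (t : ℝ) : ℝ :=
  (1 / (p : ℝ)) * ∑ i : Fin p, if hA.eigenvalues i ≤ t then 1 else 0

/-- Left end point `σ² (1 - √y)²` of the Marčenko–Pastur law (`v` is the variance parameter `σ²`). -/
def mpLeft (y v : ℝ) : ℝ := v * (1 - Real.sqrt y) ^ 2

/-- Right end point `σ² (1 + √y)²` of the Marčenko–Pastur law. -/
def mpRight (y v : ℝ) : ℝ := v * (1 + Real.sqrt y) ^ 2

/-- Density of the Marčenko–Pastur law with ratio `y ∈ (0,1)` and variance parameter `v = σ²`: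
`√((b - x) (x - a)) / (2 π x y σ²)` on `[a, b]`, and `0` elsewhere. -/
def mpDensity (y v x : ℝ) : ℝ :=
  if mpLeft y v ≤ x ∧ x ≤ mpRight y v then
    1 / (2 * Real.pi * x * y * v) * Real.sqrt ((mpRight y v - x) * (x - mpLeft y v))
  else 0

/-- The Marčenko–Pastur law with ratio `y ∈ (0,1)` and variance parameter `v`. -/
def mpLaw (y v : ℝ) : Measure ℝ :=
  volume.withDensity fun x => ENNReal.ofReal (mpDensity y v x)

/-- Weak convergence of distribution functions to the law `ν`: pointwise convergence at every
continuity point of the distribution function `t ↦ ν (-∞, t]`. -/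
def ConvergesWeaklyTo (F : ℕ → ℝ → ℝ) (ν : Measure ℝ) : Prop :=
  ∀ t : ℝ, ContinuousAt (fun s => ν.real (Set.Iic s)) t →
    Tendsto (fun n => F n t) atTop (𝓝 (ν.real (Set.Iic t)))

/-- The observations: the vector `X_i = (X_{1i}, …, X_{pi})ᵀ` collects the first `p` entries of the
`i`-th column of the array, and there are `n` of them. -/
def observations {Ω : Type*} (X : ℕ → ℕ → Ω → ℝ) (p n : ℕ) (ω : Ω) :
    Fin n → EuclideanSpace ℝ (Fin p) :=
  fun i => WithLp.toLp 2 fun k => X k i ω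

end

/-!
The empirical spectral distribution of `½ p K_n` is controlled through its Stieltjes transform on
the negative half-axis, `s_n(t) = p⁻¹ tr (½ p K_n + t)⁻¹` for `t > 0`. There everything is real:
the resolvent of a positive semidefinite matrix is symmetric, and bounded by `1 / t`.

*Reduction to a sample covariance matrix.* The map `A ↦ tr (A + t)⁻¹` is Lipschitz in trace norm
(`abs_trace_regInv_sub_le`), and a rank-one perturbation of any size moves it by at most `1 / t`
(`trace_regInv_sub_add_rankOne`). For independent columns `‖X_i - X_j‖² / 2 = p + O(√p)` in `L¹`,
so each normalisation in `K_n` may be replaced by `2 p`. The resulting U-statistic is the sample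
covariance matrix `(2 (n - 1))⁻¹ ∑ X_i X_iᵀ`, up to a rank-one centering
(`abs_trace_kendall_sub_sampleCov_le`).

*The mean.* For `B = c ∑ X_i X_iᵀ` the identity `tr ((B + t) (B + t)⁻¹) = p`, the Sherman–Morrison
formula and the concentration of the quadratic forms `X_i · R X_i` around `tr R`, for the resolvent
`R` that leaves `X_i` out, show that `s = p⁻¹ tr (B + t)⁻¹` solves
`t s + (n c) s / (1 + c p s) = 1` up to an error that vanishes in `L¹`. The left-hand side has slope
at least `t` in `s`, so `s` is close to the root of the limiting equation
`t s + ½ s / (1 + ½ y s) = 1` (`integral_abs_trace_sampleCov_sub_le`). The quadratic forms are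
where the fourth moment enters (`integral_quadraticForm_sub_trace_sq_le`).

*Almost sure convergence.* Each pair contributes to `½ p K_n` a matrix of trace norm at most
`p / (n (n - 1))`, whatever the data. Hence `s_n(t)`, as a function of the `n` independent columns,
has bounded differences of order `1 / n` (`kendall_bounded_difference`). McDiarmid's inequality
(`measure_abs_sub_integral_ge_le`) and the Borel–Cantelli lemma give `s_n(t) - E s_n(t) → 0`
almost surely.

*Identification of the limit.* The Stieltjes transform of the Marčenko–Pastur law is an explicit
integral and solves the same equation (`mpLaw_self_consistent`). Convergence at the countably many
points `t = 1 + 1 / (m + 1)` gives convergence of the integrals of all powers of `(1 + x)⁻¹`, hence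
of all continuous functions of `(1 + x)⁻¹` by the Weierstrass theorem, and so convergence of the
distribution functions (`convergesWeaklyTo_of_trace_regInv`).
-/

open Matrix

/-! ### Resolvents of positive semidefinite matrices -/

section LinearAlgebra

variable {ι : Type*} [Fintype ι]

theorem dotProduct_self_nonneg_real (v : ι → ℝ) : 0 ≤ v ⬝ᵥ v :=
  Finset.sum_nonneg fun i _ => mul_self_nonneg (v i)

theorem dotProduct_sq_le (u v : ι → ℝ) : (u ⬝ᵥ v) ^ 2 ≤ (u ⬝ᵥ u) * (v ⬝ᵥ v) := by
  simpa [dotProduct, sq] using Finset.sum_mul_sq_le_sq_mul_sq Finset.univ u v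

theorem trace_mul_vecMulVec_mul (M N : Matrix ι ι ℝ) (u v : ι → ℝ) :
    (M * vecMulVec u v * N).trace = v ⬝ᵥ (N * M) *ᵥ u := by
  rw [Matrix.trace_mul_comm, ← mul_assoc, mul_vecMulVec, trace_vecMulVec, dotProduct_comm]

theorem posSemidef_smul_vecMulVec_self {c : ℝ} (hc : 0 ≤ c) (v : ι → ℝ) :
    (c • vecMulVec v v).PosSemidef := by
  have := (posSemidef_vecMulVec_self_star v).smul hc
  simpa using this

variable [DecidableEq ι]

/-- The resolvent `(A + t)⁻¹` of a matrix at the point `-t` of the negative half-axis. -/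
noncomputable def regInv (A : Matrix ι ι ℝ) (t : ℝ) : Matrix ι ι ℝ := (A + t • 1)⁻¹

omit [Fintype ι] in
theorem posDef_add_smul_one {A : Matrix ι ι ℝ} (hA : A.PosSemidef) {t : ℝ} (ht : 0 < t) :
    (A + t • (1 : Matrix ι ι ℝ)).PosDef :=
  Matrix.PosDef.posSemidef_add hA (Matrix.PosDef.one.smul ht)

theorem det_add_smul_one_ne_zero {A : Matrix ι ι ℝ} (hA : A.PosSemidef) {t : ℝ} (ht : 0 < t) :
    (A + t • (1 : Matrix ι ι ℝ)).det ≠ 0 :=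
  (posDef_add_smul_one hA ht).det_pos.ne'

theorem regInv_mul {A : Matrix ι ι ℝ} (hA : A.PosSemidef) {t : ℝ} (ht : 0 < t) :
    regInv A t * (A + t • 1) = 1 :=
  Matrix.nonsing_inv_mul _ (isUnit_iff_ne_zero.2 (det_add_smul_one_ne_zero hA ht))

theorem mul_regInv {A : Matrix ι ι ℝ} (hA : A.PosSemidef) {t : ℝ} (ht : 0 < t) :
    (A + t • 1) * regInv A t = 1 :=
  Matrix.mul_nonsing_inv _ (isUnit_iff_ne_zero.2 (det_add_smul_one_ne_zero hA ht))

theorem regInv_posSemidef {A : Matrix ι ι ℝ} (hA : A.PosSemidef) {t : ℝ} (ht : 0 < t) :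
    (regInv A t).PosSemidef := (posDef_add_smul_one hA ht).inv.posSemidef

theorem regInv_transpose {A : Matrix ι ι ℝ} (hA : A.PosSemidef) {t : ℝ} (ht : 0 < t) :
    (regInv A t)ᵀ = regInv A t := by
  have := (regInv_posSemidef hA ht).isHermitian
  rwa [Matrix.IsHermitian, Matrix.conjTranspose_eq_transpose_of_trivial] at this

theorem dotProduct_regInv_mulVec {A : Matrix ι ι ℝ} (hA : A.PosSemidef) {t : ℝ} (ht : 0 < t)
    (u v : ι → ℝ) : u ⬝ᵥ regInv A t *ᵥ v = regInv A t *ᵥ u ⬝ᵥ v := by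
  rw [dotProduct_mulVec, ← mulVec_transpose, regInv_transpose hA ht]

/-- `t |R v|² ≤ v · R v` for the resolvent `R = (A + t)⁻¹` of a positive semidefinite matrix. -/
theorem mul_regInv_mulVec_sq_le {A : Matrix ι ι ℝ} (hA : A.PosSemidef) {t : ℝ} (ht : 0 < t)
    (v : ι → ℝ) :
    t * (regInv A t *ᵥ v ⬝ᵥ regInv A t *ᵥ v) ≤ v ⬝ᵥ regInv A t *ᵥ v := by
  set w := regInv A t *ᵥ v with hw
  have h1 : (A + t • 1) *ᵥ w = v := by
    rw [hw, mulVec_mulVec, mul_regInv hA ht, one_mulVec]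
  have h2 : 0 ≤ w ⬝ᵥ A *ᵥ w := by simpa using hA.dotProduct_mulVec_nonneg w
  calc t * (w ⬝ᵥ w) ≤ w ⬝ᵥ A *ᵥ w + t * (w ⬝ᵥ w) := by linarith
    _ = w ⬝ᵥ v := by
      rw [← h1, add_mulVec, dotProduct_add, smul_mulVec, one_mulVec, dotProduct_smul, smul_eq_mul]
    _ = v ⬝ᵥ w := dotProduct_comm _ _

theorem dotProduct_regInv_nonneg {A : Matrix ι ι ℝ} (hA : A.PosSemidef) {t : ℝ} (ht : 0 < t)
    (v : ι → ℝ) : 0 ≤ v ⬝ᵥ regInv A t *ᵥ v := by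
  simpa using (regInv_posSemidef hA ht).dotProduct_mulVec_nonneg v

theorem regInv_mulVec_sq_le {A : Matrix ι ι ℝ} (hA : A.PosSemidef) {t : ℝ} (ht : 0 < t)
    (v : ι → ℝ) :
    regInv A t *ᵥ v ⬝ᵥ regInv A t *ᵥ v ≤ (v ⬝ᵥ v) / t ^ 2 := by
  have h1 := mul_regInv_mulVec_sq_le hA ht v
  have h2 := dotProduct_sq_le v (regInv A t *ᵥ v)
  have h3 := dotProduct_self_nonneg_real (regInv A t *ᵥ v)
  have h4 := dotProduct_self_nonneg_real v
  set a := regInv A t *ᵥ v ⬝ᵥ regInv A t *ᵥ v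
  set q := v ⬝ᵥ regInv A t *ᵥ v
  rw [le_div_iff₀ (by positivity)]
  rcases h3.eq_or_lt with h | h
  · rw [← h]; simpa using h4
  · have : t * a * (t * a) ≤ q * q := mul_self_le_mul_self (by positivity) h1
    have h5 : a * (a * t ^ 2) ≤ a * (v ⬝ᵥ v) := by nlinarith
    exact le_of_mul_le_mul_left h5 h

theorem abs_regInv_dotProduct_regInv_le {A B : Matrix ι ι ℝ} (hA : A.PosSemidef)
    (hB : B.PosSemidef) {t : ℝ} (ht : 0 < t) (v : ι → ℝ) :
    |regInv A t *ᵥ v ⬝ᵥ regInv B t *ᵥ v| ≤ (v ⬝ᵥ v) / t ^ 2 := by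
  have h1 := regInv_mulVec_sq_le hA ht v
  have h2 := regInv_mulVec_sq_le hB ht v
  have h3 := dotProduct_sq_le (regInv A t *ᵥ v) (regInv B t *ᵥ v)
  have h4 : 0 ≤ (v ⬝ᵥ v) / t ^ 2 := div_nonneg (dotProduct_self_nonneg_real v) (by positivity)
  apply abs_le_of_sq_le_sq _ h4
  calc _ ≤ _ := h3
    _ ≤ (v ⬝ᵥ v) / t ^ 2 * ((v ⬝ᵥ v) / t ^ 2) :=
      mul_le_mul h1 h2 (dotProduct_self_nonneg_real _) h4
    _ = _ := by ring

theorem regInv_sub_regInv {A B : Matrix ι ι ℝ} (hA : A.PosSemidef) (hB : B.PosSemidef) {t : ℝ}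
    (ht : 0 < t) : regInv A t - regInv B t = regInv A t * (B - A) * regInv B t := by
  have : B - A = (B + t • 1) - (A + t • 1) := by abel
  rw [this, mul_sub, sub_mul, mul_assoc, mul_regInv hB ht, regInv_mul hA ht, mul_one, one_mul]

/-- The trace of the resolvent is Lipschitz for sums of rank-one perturbations: this is the bound
`|tr (A + t)⁻¹ - tr (B + t)⁻¹| ≤ ‖B - A‖₁ / t²` in trace norm, for an explicit decomposition. -/
theorem abs_trace_regInv_sub_le {A B : Matrix ι ι ℝ} (hA : A.PosSemidef) (hB : B.PosSemidef)
    {t : ℝ} (ht : 0 < t) {κ : Type*} (s : Finset κ) (c : κ → ℝ) (u : κ → ι → ℝ)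
    (h : B - A = ∑ k ∈ s, c k • vecMulVec (u k) (u k)) :
    |(regInv A t).trace - (regInv B t).trace| ≤ ∑ k ∈ s, |c k| * (u k ⬝ᵥ u k) / t ^ 2 := by
  rw [← trace_sub, regInv_sub_regInv hA hB ht, h, Finset.mul_sum, Finset.sum_mul, trace_sum]
  refine (Finset.abs_sum_le_sum_abs _ _).trans (Finset.sum_le_sum fun k _ => ?_)
  rw [mul_smul_comm, smul_mul_assoc, trace_smul, trace_mul_vecMulVec_mul, smul_eq_mul, abs_mul,
    ← mulVec_mulVec, dotProduct_regInv_mulVec hB ht, mul_div_assoc]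
  exact mul_le_mul_of_nonneg_left (abs_regInv_dotProduct_regInv_le hB hA ht _) (abs_nonneg _)

/-- Sherman–Morrison: `(A + c v vᵀ + t)⁻¹ v = (1 + c v·(A + t)⁻¹ v)⁻¹ (A + t)⁻¹ v`. -/
theorem regInv_add_rankOne_mulVec {A : Matrix ι ι ℝ} (hA : A.PosSemidef) {c : ℝ} (hc : 0 ≤ c)
    (v : ι → ℝ) (hB : (A + c • vecMulVec v v).PosSemidef) {t : ℝ} (ht : 0 < t) :
    regInv (A + c • vecMulVec v v) t *ᵥ v =
      (1 + c * (v ⬝ᵥ regInv A t *ᵥ v))⁻¹ • regInv A t *ᵥ v := by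
  have hq := dotProduct_regInv_nonneg hA ht v
  set q := v ⬝ᵥ regInv A t *ᵥ v with hqd
  have hne : 1 + c * q ≠ 0 := by positivity
  have h1 : (A + c • vecMulVec v v + t • 1) *ᵥ (regInv A t *ᵥ v) = (1 + c * q) • v := by
    have : A + c • vecMulVec v v + t • (1 : Matrix ι ι ℝ) = (A + t • 1) + c • vecMulVec v v := by
      abel
    rw [this, add_mulVec, mulVec_mulVec, mul_regInv hA ht, one_mulVec, smul_mulVec,
      vecMulVec_mulVec, ← hqd, add_smul, one_smul, mul_smul]
    simp
  have h2 := congrArg (fun w => regInv (A + c • vecMulVec v v) t *ᵥ w) h1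
  simp only [mulVec_mulVec, mulVec_smul] at h2
  rw [← mul_assoc, regInv_mul hB ht, one_mul] at h2
  rw [h2, smul_smul, inv_mul_cancel₀ hne, one_smul]

/-- A positive rank-one perturbation lowers the trace of the resolvent by at most `1 / t`,
whatever its size. -/
theorem trace_regInv_sub_add_rankOne {A : Matrix ι ι ℝ} (hA : A.PosSemidef) {c : ℝ} (hc : 0 ≤ c)
    (v : ι → ℝ) {t : ℝ} (ht : 0 < t) :
    |(regInv A t).trace - (regInv (A + c • vecMulVec v v) t).trace| ≤ 1 / t := by
  have hB := hA.add (posSemidef_smul_vecMulVec_self hc v)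
  have hq := dotProduct_regInv_nonneg hA ht v
  rw [← trace_sub, regInv_sub_regInv hA hB ht, add_sub_cancel_left, mul_smul_comm, smul_mul_assoc,
    trace_smul, trace_mul_vecMulVec_mul, smul_eq_mul, ← mulVec_mulVec,
    dotProduct_regInv_mulVec hB ht, regInv_add_rankOne_mulVec hA hc v hB ht, smul_dotProduct,
    smul_eq_mul]
  have h1 := mul_regInv_mulVec_sq_le hA ht v
  have h3 := dotProduct_self_nonneg_real (regInv A t *ᵥ v)
  set a := regInv A t *ᵥ v ⬝ᵥ regInv A t *ᵥ v
  set q := v ⬝ᵥ regInv A t *ᵥ v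
  have h4 : 0 < 1 + c * q := by positivity
  rw [abs_of_nonneg (by positivity), ← mul_assoc, mul_comm c, mul_assoc, inv_mul_le_iff₀ h4,
    ← div_eq_mul_one_div, le_div_iff₀ ht]
  nlinarith

theorem dotProduct_regInv_add_rankOne {A : Matrix ι ι ℝ} (hA : A.PosSemidef) {c : ℝ} (hc : 0 ≤ c)
    (v : ι → ℝ) {t : ℝ} (ht : 0 < t) :
    c * (v ⬝ᵥ regInv (A + c • vecMulVec v v) t *ᵥ v) =
      1 - 1 / (1 + c * (v ⬝ᵥ regInv A t *ᵥ v)) := by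
  have hB := hA.add (posSemidef_smul_vecMulVec_self hc v)
  have hq := dotProduct_regInv_nonneg hA ht v
  have hne : 1 + c * (v ⬝ᵥ regInv A t *ᵥ v) ≠ 0 := by positivity
  rw [regInv_add_rankOne_mulVec hA hc v hB ht, dotProduct_smul, smul_eq_mul]
  field_simp
  ring

theorem trace_regInv_nonneg {A : Matrix ι ι ℝ} (hA : A.PosSemidef) {t : ℝ} (ht : 0 < t) :
    0 ≤ (regInv A t).trace := (regInv_posSemidef hA ht).trace_nonneg

theorem sum_regInv_sq_le {A : Matrix ι ι ℝ} (hA : A.PosSemidef) {t : ℝ} (ht : 0 < t) :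
    ∑ k, ∑ l, regInv A t k l ^ 2 ≤ Fintype.card ι / t ^ 2 := by
  rw [Finset.sum_comm]
  calc ∑ l, ∑ k, regInv A t k l ^ 2
      = ∑ l, regInv A t *ᵥ Pi.single l 1 ⬝ᵥ regInv A t *ᵥ Pi.single l 1 := by
        simp [dotProduct, sq]
    _ ≤ ∑ l : ι, (Pi.single l 1 ⬝ᵥ Pi.single l (1 : ℝ)) / t ^ 2 :=
        Finset.sum_le_sum fun l _ => regInv_mulVec_sq_le hA ht _
    _ = _ := by simp [div_eq_mul_inv]

theorem trace_regInv_le {A : Matrix ι ι ℝ} (hA : A.PosSemidef) {t : ℝ} (ht : 0 < t) :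
    (regInv A t).trace ≤ Fintype.card ι / t := by
  have h : ∀ i, regInv A t i i ≤ 1 / t := fun i => by
    have h1 := mul_regInv_mulVec_sq_le hA ht (Pi.single i 1)
    have h2 : regInv A t i i ^ 2 ≤
        regInv A t *ᵥ Pi.single i 1 ⬝ᵥ regInv A t *ᵥ Pi.single i 1 := by
      simp only [dotProduct, mulVec_single_one, col_apply, ← sq]
      exact Finset.single_le_sum (f := fun k => regInv A t k i ^ 2)
        (fun _ _ => sq_nonneg _) (Finset.mem_univ i)
    have h3 : 0 ≤ regInv A t i i := (regInv_posSemidef hA ht).diag_nonneg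
    simp only [mulVec_single_one, single_one_dotProduct, col_apply] at h1 h2
    rw [le_div_iff₀ ht]
    by_contra hcon
    push Not at hcon
    have h4 : 0 < regInv A t i i := pos_of_mul_pos_left (one_pos.trans hcon) ht.le
    have h5 := mul_lt_mul_of_pos_left hcon h4
    have h6 := mul_le_mul_of_nonneg_left h2 ht.le
    nlinarith
  calc (regInv A t).trace ≤ ∑ _i : ι, 1 / t := Finset.sum_le_sum fun i _ => h i
    _ = _ := by simp [div_eq_mul_inv]

/-- The trace of the resolvent in terms of the eigenvalues. -/
theorem trace_regInv_eq_sum_eigenvalues {A : Matrix ι ι ℝ} (hA : A.PosSemidef) {t : ℝ}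
    (ht : 0 < t) :
    (regInv A t).trace = ∑ i, 1 / (hA.isHermitian.eigenvalues i + t) := by
  set U : Matrix ι ι ℝ := (hA.isHermitian.eigenvectorUnitary : Matrix ι ι ℝ) with hU
  set D : Matrix ι ι ℝ := diagonal hA.isHermitian.eigenvalues with hD
  have hUU : U * star U = 1 := Unitary.mul_star_self_of_mem
    hA.isHermitian.eigenvectorUnitary.2
  have hUU' : star U * U = 1 := Unitary.star_mul_self_of_mem
    hA.isHermitian.eigenvectorUnitary.2
  have hspec : A = U * D * star U := by
    have := hA.isHermitian.spectral_theorem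
    rw [Unitary.conjStarAlgAut_apply] at this
    exact this
  set E : Matrix ι ι ℝ := diagonal fun i => 1 / (hA.isHermitian.eigenvalues i + t) with hE
  have hDE : (D + t • 1) * E = 1 := by
    rw [hD, hE, smul_one_eq_diagonal, diagonal_add, diagonal_mul_diagonal, ← diagonal_one]
    congr 1
    ext i
    have : hA.isHermitian.eigenvalues i + t ≠ 0 :=
      (add_pos_of_nonneg_of_pos (hA.eigenvalues_nonneg i) ht).ne'
    field_simp
  have hinv : regInv A t = U * E * star U := by
    apply Matrix.inv_eq_right_inv
    have h1 : A + t • 1 = U * (D + t • 1) * star U := by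
      rw [mul_add, add_mul, ← hspec, mul_smul_comm, mul_one, smul_mul_assoc, hUU]
    calc (A + t • 1) * (U * E * star U) = U * (D + t • 1) * (star U * U) * E * star U := by
          rw [h1]; simp only [mul_assoc]
      _ = U * ((D + t • 1) * E) * star U := by rw [hUU']; simp only [mul_assoc, one_mul]
      _ = 1 := by rw [hDE, mul_one, hUU]
  rw [hinv, trace_mul_comm, ← mul_assoc, hUU', one_mul, hE, trace_diagonal]

end LinearAlgebra

/-! ### McDiarmid's inequality -/

section BoundedDifferences

variable {E : Type*} [MeasurableSpace E] (ν : Measure E) [IsProbabilityMeasure ν]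

theorem measurePreserving_insertNth {n : ℕ} (i : Fin (n + 1)) :
    MeasurePreserving (fun z : E × (Fin n → E) => (i.insertNth z.1 z.2 : Fin (n + 1) → E))
      (ν.prod (Measure.pi fun _ => ν)) (Measure.pi fun _ => ν) :=
  (measurePreserving_piFinSuccAbove (fun _ : Fin (n + 1) => ν) i).symm

theorem measurable_insertNth {n : ℕ} (i : Fin (n + 1)) :
    Measurable (fun z : E × (Fin n → E) => (i.insertNth z.1 z.2 : Fin (n + 1) → E)) :=
  (MeasurableEquiv.piFinSuccAbove (fun _ : Fin (n + 1) => E) i).symm.measurable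

theorem integrable_comp_insertNth {n : ℕ} (i : Fin (n + 1)) {F : (Fin (n + 1) → E) → ℝ}
    (hF : Integrable F (Measure.pi fun _ => ν)) :
    Integrable (fun z : E × (Fin n → E) => F (i.insertNth z.1 z.2))
      (ν.prod (Measure.pi fun _ => ν)) :=
  (measurePreserving_insertNth ν i).integrable_comp_of_integrable hF

/-- Integrating out the `i`-th of `n + 1` independent coordinates first. -/
theorem integral_pi_insertNth {n : ℕ} (i : Fin (n + 1)) {F : (Fin (n + 1) → E) → ℝ}
    (hF : Integrable F (Measure.pi fun _ => ν)) :
    ∫ x, F x ∂Measure.pi (fun _ => ν) =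
      ∫ r, ∫ e, F (i.insertNth e r) ∂ν ∂Measure.pi (fun _ : Fin n => ν) := by
  rw [← integral_prod_symm _ (integrable_comp_insertNth ν i hF)]
  exact ((measurePreserving_insertNth ν i).integral_comp
    (MeasurableEquiv.piFinSuccAbove (fun _ : Fin (n + 1) => E) i).symm.measurableEmbedding F).symm

theorem integrable_of_abs_le {α : Type*} [MeasurableSpace α] {m : Measure α} [IsFiniteMeasure m]
    {f : α → ℝ} (hf : Measurable f) {M : ℝ} (hM : ∀ x, |f x| ≤ M) : Integrable f m :=
  Integrable.of_bound hf.aestronglyMeasurable M (Eventually.of_forall hM)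

theorem abs_integral_le_of_abs_le {α : Type*} [MeasurableSpace α] {m : Measure α}
    [IsProbabilityMeasure m] {f : α → ℝ} {M : ℝ} (hM : ∀ x, |f x| ≤ M) : |∫ x, f x ∂m| ≤ M := by
  have h := norm_integral_le_of_norm_le_const (μ := m) (f := f) (C := M)
    (Eventually.of_forall fun x => hM x)
  simpa using h

/-- McDiarmid's inequality in exponential form: a function of `n` independent variables that
changes by at most `c` when one variable changes is sub-Gaussian with variance proxy `n c²`. The
variables are integrated out one at a time, with Hoeffding's lemma for each. -/
theorem integral_exp_le_of_boundedDifferences {c : ℝ} (hc : 0 ≤ c) (l : ℝ) :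
    ∀ (n : ℕ) (f : (Fin n → E) → ℝ), Measurable f → (∃ M, ∀ x, |f x| ≤ M) →
      (∀ x i e, |f (Function.update x i e) - f x| ≤ c) →
      ∫ x, Real.exp (l * (f x - ∫ x', f x' ∂Measure.pi (fun _ => ν))) ∂Measure.pi (fun _ => ν) ≤
        Real.exp (n * (c ^ 2 * l ^ 2 / 2)) := by
  intro n
  induction n with
  | zero =>
    intro f hf hM hd
    have h : ∀ x, f x = f (fun i => i.elim0) := fun x => by congr 1; ext i; exact i.elim0
    simp [h]
  | succ n ih =>
    rintro f hf ⟨M, hM⟩ hd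
    set P := Measure.pi (fun _ : Fin n => ν) with hP
    have hfm := hf.comp (measurable_insertNth (E := E) (0 : Fin (n + 1)))
    set g : (Fin n → E) → ℝ := fun r => ∫ e, f ((0 : Fin (n + 1)).insertNth e r) ∂ν with hg
    have hsec : ∀ r, Measurable fun e => f ((0 : Fin (n + 1)).insertNth e r) := fun r =>
      hfm.comp (measurable_id.prodMk measurable_const)
    have hseci : ∀ r, Integrable (fun e => f ((0 : Fin (n + 1)).insertNth e r)) ν := fun r =>
      integrable_of_abs_le (hsec r) fun _ => hM _
    have hgm : Measurable g :=
      (StronglyMeasurable.integral_prod_left' (μ := ν) (hfm.stronglyMeasurable)).measurable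
    have hgM : ∀ r, |g r| ≤ M := fun r =>
      abs_integral_le_of_abs_le fun e => hM _
    have hgd : ∀ r i e, |g (Function.update r i e) - g r| ≤ c := fun r i e => by
      rw [hg]
      simp only
      rw [← integral_sub (hseci _) (hseci _)]
      refine abs_integral_le_of_abs_le fun e' => ?_
      have := hd ((0 : Fin (n + 1)).insertNth e' r) i.succ e
      simp only [Fin.insertNth_zero', ← Fin.cons_update] at this ⊢
      exact this
    have hmean : ∫ x, f x ∂Measure.pi (fun _ => ν) = ∫ r, g r ∂P :=
      integral_pi_insertNth ν 0 (integrable_of_abs_le hf hM)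
    set m := ∫ r, g r ∂P
    rw [hmean]
    have hbe : ∀ a b : ℝ, |a| ≤ M → |b| ≤ M →
        |Real.exp (l * (a - b))| ≤ Real.exp (|l| * (M + M)) := fun a b ha hb => by
      rw [abs_of_pos (Real.exp_pos _), Real.exp_le_exp]
      refine (le_abs_self _).trans ?_
      rw [abs_mul]
      exact mul_le_mul_of_nonneg_left ((abs_sub a b).trans (add_le_add ha hb)) (abs_nonneg _)
    have hmM : |m| ≤ M := abs_integral_le_of_abs_le hgM
    rw [integral_pi_insertNth ν 0 (integrable_of_abs_le
      (by fun_prop) fun x => hbe _ _ (hM x) hmM)]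
    have hstep : ∀ r, ∫ e, Real.exp (l * (f ((0 : Fin (n + 1)).insertNth e r) - m)) ∂ν ≤
        Real.exp (c ^ 2 * l ^ 2 / 2) * Real.exp (l * (g r - m)) := fun r => by
      have hsplit : ∀ e, Real.exp (l * (f ((0 : Fin (n + 1)).insertNth e r) - m)) =
          Real.exp (l * (f ((0 : Fin (n + 1)).insertNth e r) - g r)) *
            Real.exp (l * (g r - m)) := fun e => by
        rw [← Real.exp_add]; congr 1; ring
      simp_rw [hsplit]
      rw [integral_mul_const]
      refine mul_le_mul_of_nonneg_right ?_ (Real.exp_pos _).le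
      have hcl : ∀ e, f ((0 : Fin (n + 1)).insertNth e r) - g r ∈ Set.Icc (-c) c := fun e => by
        rw [Set.mem_Icc, ← abs_le]
        have : f ((0 : Fin (n + 1)).insertNth e r) - g r =
            ∫ e', (f ((0 : Fin (n + 1)).insertNth e r) -
              f ((0 : Fin (n + 1)).insertNth e' r)) ∂ν := by
          rw [integral_sub (integrable_const _) (hseci r)]; simp [hg]
        rw [this]
        refine abs_integral_le_of_abs_le fun e' => ?_
        have := hd ((0 : Fin (n + 1)).insertNth e' r) 0 e
        simp only [Fin.insertNth_zero', Fin.update_cons_zero] at this ⊢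
        exact this
      have hsub := hasSubgaussianMGF_of_mem_Icc_of_integral_eq_zero (μ := ν)
        ((hsec r).sub_const (g r)).aemeasurable (Eventually.of_forall hcl)
        (by rw [integral_sub (hseci r) (integrable_const _)]; simp [hg])
      refine (hsub.mgf_le l).trans (le_of_eq ?_)
      congr 2
      have : ((‖c - -c‖₊ / 2) ^ 2 : NNReal) = (c ^ 2 : ℝ) := by
        push_cast
        rw [sub_neg_eq_add, Real.norm_of_nonneg (by positivity)]
        ring
      rw [this]
    have hgi : Integrable (fun r => Real.exp (l * (g r - m))) P :=
      integrable_of_abs_le (by fun_prop) fun r => hbe _ _ (hgM r) hmM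
    calc _ ≤ ∫ r, Real.exp (c ^ 2 * l ^ 2 / 2) * Real.exp (l * (g r - m)) ∂P := by
          refine integral_mono ?_ (hgi.const_mul _) hstep
          exact (integrable_comp_insertNth ν 0 (integrable_of_abs_le
            (f := fun x => Real.exp (l * (f x - m))) (by fun_prop)
            fun x => hbe _ _ (hM x) hmM)).integral_prod_right
      _ = Real.exp (c ^ 2 * l ^ 2 / 2) * ∫ r, Real.exp (l * (g r - m)) ∂P := integral_const_mul _ _
      _ ≤ Real.exp (c ^ 2 * l ^ 2 / 2) * Real.exp (n * (c ^ 2 * l ^ 2 / 2)) :=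
          mul_le_mul_of_nonneg_left (ih g hgm ⟨M, hgM⟩ hgd) (Real.exp_pos _).le
      _ = _ := by rw [← Real.exp_add]; congr 1; push_cast; ring

/-- McDiarmid's inequality, both tails, with the exponential parameter `l` left free. -/
theorem measure_abs_sub_integral_ge_le {c : ℝ} (hc : 0 ≤ c) {n : ℕ} {f : (Fin n → E) → ℝ}
    (hf : Measurable f) (hM : ∃ M, ∀ x, |f x| ≤ M)
    (hd : ∀ x i e, |f (Function.update x i e) - f x| ≤ c) {ε l : ℝ} (hl : 0 ≤ l) :
    (Measure.pi fun _ => ν).real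
        {x | ε ≤ |f x - ∫ x', f x' ∂Measure.pi (fun _ => ν)|} ≤
      2 * Real.exp (n * (c ^ 2 * l ^ 2 / 2) - l * ε) := by
  set P := Measure.pi (fun _ : Fin n => ν)
  set m := ∫ x', f x' ∂P
  obtain ⟨M, hM'⟩ := hM
  have hint : ∀ l : ℝ, Integrable (fun x => Real.exp (l * (f x - m))) P := fun l => by
    refine integrable_of_abs_le (M := Real.exp (|l| * (M + |m|))) (by fun_prop) fun x => ?_
    rw [abs_of_pos (Real.exp_pos _), Real.exp_le_exp]
    refine (le_abs_self _).trans ?_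
    rw [abs_mul]
    exact mul_le_mul_of_nonneg_left ((abs_sub _ _).trans (add_le_add (hM' x) le_rfl))
      (abs_nonneg _)
  have hU := measure_ge_le_exp_mul_mgf (X := fun x => f x - m) ε hl (hint l)
  have hL := measure_le_le_exp_mul_mgf (X := fun x => f x - m) (-ε) (neg_nonpos.2 hl) (hint (-l))
  have h1 := integral_exp_le_of_boundedDifferences ν hc l n f hf ⟨M, hM'⟩ hd
  have h2 := integral_exp_le_of_boundedDifferences ν hc (-l) n f hf ⟨M, hM'⟩ hd
  have hsub : {x | ε ≤ |f x - m|} ⊆ {x | ε ≤ f x - m} ∪ {x | f x - m ≤ -ε} := by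
    intro x hx
    rw [Set.mem_ofPred_eq] at hx
    rcases le_abs'.1 hx with h | h
    · exact Or.inr h
    · exact Or.inl h
  calc P.real {x | ε ≤ |f x - m|} ≤ P.real ({x | ε ≤ f x - m} ∪ {x | f x - m ≤ -ε}) :=
        measureReal_mono hsub
    _ ≤ P.real {x | ε ≤ f x - m} + P.real {x | f x - m ≤ -ε} := measureReal_union_le _ _
    _ ≤ Real.exp (-l * ε) * Real.exp (n * (c ^ 2 * l ^ 2 / 2)) +
        Real.exp (-(-l) * -ε) * Real.exp (n * (c ^ 2 * (-l) ^ 2 / 2)) :=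
        add_le_add (hU.trans (mul_le_mul_of_nonneg_left h1 (Real.exp_pos _).le))
          (hL.trans (mul_le_mul_of_nonneg_left h2 (Real.exp_pos _).le))
    _ = _ := by rw [← Real.exp_add, ← Real.exp_add, two_mul]; congr 2 <;> ring

end BoundedDifferences

/-! ### Concentration of quadratic forms -/

section QuadraticForms

variable {ρ : Measure ℝ} [IsProbabilityMeasure ρ]

theorem memLp_eval (h4 : MemLp id 4 ρ) {p : ℕ} (k : Fin p) :
    MemLp (fun x : Fin p → ℝ => x k) 4 (Measure.pi fun _ => ρ) :=
  h4.comp_measurePreserving (measurePreserving_eval (fun _ : Fin p => ρ) k)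

theorem memLp_quadraticForm (h4 : MemLp id 4 ρ) {p : ℕ} (A : Matrix (Fin p) (Fin p) ℝ) :
    MemLp (fun x : Fin p → ℝ => x ⬝ᵥ A *ᵥ x - A.trace) 2 (Measure.pi fun _ => ρ) := by
  refine MemLp.sub ?_ (memLp_const _)
  simp only [dotProduct, mulVec]
  refine memLp_finsetSum _ fun i _ => ?_
  simp only [Finset.mul_sum]
  refine memLp_finsetSum _ fun j _ => ?_
  have : ∀ x : Fin p → ℝ, x i * (A i j * x j) = A i j * (x i * x j) := fun x => by ring
  simp only [this]
  have : ENNReal.HolderTriple 4 4 2 := ⟨by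
    rw [← two_mul, show (4 : ENNReal) = 2 * 2 by norm_num,
      ENNReal.mul_inv (by norm_num) (by norm_num), ← mul_assoc,
      ENNReal.mul_inv_cancel (by norm_num) (by norm_num), one_mul]⟩
  exact ((memLp_eval h4 j).mul' (memLp_eval h4 i)).const_mul _

theorem memLp_dotProduct (h4 : MemLp id 4 ρ) {p : ℕ} (b : Fin p → ℝ) :
    MemLp (fun x : Fin p → ℝ => b ⬝ᵥ x) 2 (Measure.pi fun _ => ρ) := by
  simp only [dotProduct]
  exact memLp_finsetSum _ fun i _ =>
    ((memLp_eval h4 i).mono_exponent (by norm_num)).const_mul _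

theorem integrable_pow_of_memLp_four (h4 : MemLp id 4 ρ) :
    Integrable (fun x : ℝ => x) ρ ∧ Integrable (fun x : ℝ => x ^ 2) ρ ∧
      Integrable (fun x : ℝ => x ^ 4) ρ := by
  refine ⟨?_, ?_, ?_⟩
  · exact memLp_one_iff_integrable.1 (h4.mono_exponent (by norm_num))
  · exact (h4.mono_exponent (p := 2) (by norm_num)).integrable_sq
  · have := h4.integrable_norm_pow (p := 4) (by norm_num)
    refine this.congr (Eventually.of_forall fun x => ?_)
    simp only [id, Real.norm_eq_abs]
    exact Even.pow_abs (by decide) x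

theorem integral_dotProduct_sq (h4 : MemLp id 4 ρ) (h1 : ∫ x, x ∂ρ = 0) (h2 : ∫ x, x ^ 2 ∂ρ = 1)
    {p : ℕ} (b : Fin p → ℝ) :
    ∫ x, (b ⬝ᵥ x) ^ 2 ∂(Measure.pi fun _ : Fin p => ρ) = b ⬝ᵥ b := by
  obtain ⟨i1, i2, -⟩ := integrable_pow_of_memLp_four h4
  induction p with
  | zero => simp [dotProduct]
  | succ p ih =>
    rw [integral_pi_insertNth ρ 0 (memLp_dotProduct h4 b).integrable_sq]
    have hstep : ∀ r : Fin p → ℝ,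
        ∫ e, (b ⬝ᵥ (0 : Fin (p + 1)).insertNth (α := fun _ => ℝ) e r) ^ 2 ∂ρ =
        b 0 ^ 2 + ((fun i => b i.succ) ⬝ᵥ r) ^ 2 := fun r => by
      set L := (fun i => b i.succ) ⬝ᵥ r with hL
      have : ∀ e, (b ⬝ᵥ (0 : Fin (p + 1)).insertNth (α := fun _ => ℝ) e r) ^ 2 =
          b 0 ^ 2 * e ^ 2 + (2 * b 0 * L) * e + L ^ 2 := fun e => by
        simp only [dotProduct, Fin.sum_univ_succ, Fin.insertNth_zero', Fin.cons_zero,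
          Fin.cons_succ]
        simp only [dotProduct] at hL
        rw [← hL]
        ring
      simp_rw [this]
      rw [integral_add ((i2.const_mul _).fun_add (i1.const_mul _)) (integrable_const _),
        integral_add (i2.const_mul _) (i1.const_mul _), integral_const_mul, integral_const_mul,
        h1, h2]
      simp
    simp_rw [hstep]
    rw [integral_add (integrable_const _) (memLp_dotProduct h4 _).integrable_sq, ih]
    simp [dotProduct, Fin.sum_univ_succ, sq]

/-- Concentration of quadratic forms around the trace: the bound needs four moments only. It is
proved by integrating out one coordinate at a time; the increments are orthogonal. -/
theorem integral_quadraticForm_sub_trace_sq_le (h4 : MemLp id 4 ρ) (h1 : ∫ x, x ∂ρ = 0)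
    (h2 : ∫ x, x ^ 2 ∂ρ = 1) {p : ℕ} (A : Matrix (Fin p) (Fin p) ℝ) :
    ∫ x, (x ⬝ᵥ A *ᵥ x - A.trace) ^ 2 ∂(Measure.pi fun _ : Fin p => ρ) ≤
      (2 * ∫ x, x ^ 4 ∂ρ + 4) * ∑ i, ∑ j, A i j ^ 2 := by
  obtain ⟨i1, i2, i4⟩ := integrable_pow_of_memLp_four h4
  set m := ∫ x, x ^ 4 ∂ρ with hm
  have hm0 : 0 ≤ m := integral_nonneg fun x => by positivity
  induction p with
  | zero => simp [dotProduct, Matrix.trace]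
  | succ p ih =>
    rw [integral_pi_insertNth ρ 0 (memLp_quadraticForm h4 A).integrable_sq]
    set a := A 0 0
    set b : Fin p → ℝ := fun j => A 0 j.succ + A j.succ 0 with hb
    set A' : Matrix (Fin p) (Fin p) ℝ := A.submatrix Fin.succ Fin.succ with hA'
    have hdec : ∀ (r : Fin p → ℝ) (e : ℝ),
        ((0 : Fin (p + 1)).insertNth (α := fun _ => ℝ) e r) ⬝ᵥ
          A *ᵥ ((0 : Fin (p + 1)).insertNth (α := fun _ => ℝ) e r) - A.trace =
        a * (e ^ 2 - 1) + e * (b ⬝ᵥ r) + (r ⬝ᵥ A' *ᵥ r - A'.trace) := fun r e => by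
      simp only [dotProduct, mulVec, Matrix.trace, diag_apply, Fin.sum_univ_succ,
        Fin.insertNth_zero', Fin.cons_zero, Fin.cons_succ, hA', submatrix_apply, hb, add_mul,
        mul_add, Finset.sum_add_distrib, Finset.mul_sum]
      have : ∀ j : Fin p, r j * (A j.succ 0 * e) = e * (A j.succ 0 * r j) := fun j => by ring
      simp only [this]
      ring
    have hstep : ∀ r : Fin p → ℝ,
        ∫ e, (((0 : Fin (p + 1)).insertNth (α := fun _ => ℝ) e r) ⬝ᵥ
          A *ᵥ ((0 : Fin (p + 1)).insertNth (α := fun _ => ℝ) e r) - A.trace) ^ 2 ∂ρ ≤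
        2 * m * a ^ 2 + 2 * (b ⬝ᵥ r) ^ 2 + (r ⬝ᵥ A' *ᵥ r - A'.trace) ^ 2 := fun r => by
      simp_rw [hdec]
      set L := b ⬝ᵥ r
      set q := r ⬝ᵥ A' *ᵥ r - A'.trace
      have hint : Integrable (fun e : ℝ => (2 * a ^ 2) * e ^ 4 +
          (2 * L ^ 2 - 4 * a ^ 2 + 2 * q * a) * e ^ 2 + (2 * q * L) * e +
          (2 * a ^ 2 - 2 * q * a + q ^ 2)) ρ :=
        (((i4.const_mul _).fun_add (i2.const_mul _)).fun_add (i1.const_mul _)).fun_add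
          (integrable_const _)
      calc _ ≤ ∫ e, ((2 * a ^ 2) * e ^ 4 +
          (2 * L ^ 2 - 4 * a ^ 2 + 2 * q * a) * e ^ 2 + (2 * q * L) * e +
          (2 * a ^ 2 - 2 * q * a + q ^ 2)) ∂ρ := by
            refine integral_mono_of_nonneg (Eventually.of_forall fun e => sq_nonneg _) hint
              (Eventually.of_forall fun e => ?_)
            have := sq_nonneg (a * (e ^ 2 - 1) - e * L)
            simp only
            nlinarith
        _ = 2 * a ^ 2 * m + (2 * L ^ 2 - 4 * a ^ 2 + 2 * q * a) +
            (2 * a ^ 2 - 2 * q * a + q ^ 2) := by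
            rw [integral_add (((i4.const_mul _).fun_add (i2.const_mul _)).fun_add (i1.const_mul _))
              (integrable_const _), integral_add ((i4.const_mul _).fun_add (i2.const_mul _))
              (i1.const_mul _), integral_add (i4.const_mul _) (i2.const_mul _),
              integral_const_mul, integral_const_mul, integral_const_mul, h1, h2]
            simp [hm]
        _ ≤ _ := by nlinarith [sq_nonneg a]
    have iL := (memLp_dotProduct h4 b).integrable_sq
    have iQ := (memLp_quadraticForm h4 A').integrable_sq
    calc _ ≤ ∫ r : Fin p → ℝ, (2 * m * a ^ 2 + 2 * (b ⬝ᵥ r) ^ 2 + (r ⬝ᵥ A' *ᵥ r - A'.trace) ^ 2)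
          ∂(Measure.pi fun _ : Fin p => ρ) :=
          integral_mono_of_nonneg
            (Eventually.of_forall fun r => integral_nonneg fun e => sq_nonneg _)
            (((integrable_const _).fun_add (iL.const_mul _)).fun_add iQ)
            (Eventually.of_forall hstep)
      _ = 2 * m * a ^ 2 + 2 * (b ⬝ᵥ b) +
          ∫ r, (r ⬝ᵥ A' *ᵥ r - A'.trace) ^ 2 ∂(Measure.pi fun _ : Fin p => ρ) := by
          rw [integral_add ((integrable_const _).fun_add (iL.const_mul _)) iQ,
            integral_add (integrable_const _) (iL.const_mul _), integral_const_mul 2,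
            integral_dotProduct_sq h4 h1 h2]
          simp
      _ ≤ 2 * m * a ^ 2 + 2 * (∑ j : Fin p, 2 * (A 0 j.succ ^ 2 + A j.succ 0 ^ 2)) +
          (2 * m + 4) * ∑ i, ∑ j, A' i j ^ 2 := by
          refine add_le_add (add_le_add le_rfl (mul_le_mul_of_nonneg_left ?_ two_pos.le)) (ih A')
          refine Finset.sum_le_sum fun j _ => ?_
          simp only [hb]
          nlinarith [sq_nonneg (A 0 j.succ - A j.succ 0)]
      _ ≤ _ := by
          simp only [Fin.sum_univ_succ, hA', submatrix_apply, Finset.sum_add_distrib,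
            ← Finset.mul_sum]
          have e1 : 0 ≤ ∑ j : Fin p, A 0 j.succ ^ 2 := Finset.sum_nonneg fun _ _ => sq_nonneg _
          have e2 : 0 ≤ ∑ j : Fin p, A j.succ 0 ^ 2 := Finset.sum_nonneg fun _ _ => sq_nonneg _
          nlinarith [sq_nonneg a, mul_nonneg hm0 e1, mul_nonneg hm0 e2]

/-- An `L¹` bound from a second-moment bound. -/
theorem integral_abs_le_of_integral_sq_le {α : Type*} [MeasurableSpace α] {m : Measure α}
    [IsProbabilityMeasure m] {f : α → ℝ} (hf : MemLp f 2 m) {M : ℝ}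
    (hM : ∫ x, f x ^ 2 ∂m ≤ M) : ∫ x, |f x| ∂m ≤ √M := by
  have hi : Integrable f m := hf.integrable (by norm_num)
  refine Real.le_sqrt_of_sq_le (le_trans ?_ hM)
  set a := ∫ x, |f x| ∂m with ha
  have h : 0 ≤ ∫ x, (|f x| - a) ^ 2 ∂m := integral_nonneg fun x => sq_nonneg _
  have he : ∀ x, (|f x| - a) ^ 2 = f x ^ 2 + (-2 * a) * |f x| + a ^ 2 := fun x => by
    rw [← sq_abs (f x)]; ring
  simp_rw [he] at h
  rw [integral_add (hf.integrable_sq.fun_add (hi.abs.const_mul _)) (integrable_const _),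
    integral_add hf.integrable_sq (hi.abs.const_mul _), integral_const_mul, ← ha] at h
  simp at h
  nlinarith

theorem integral_abs_quadraticForm_sub_trace_le (h4 : MemLp id 4 ρ) (h1 : ∫ x, x ∂ρ = 0)
    (h2 : ∫ x, x ^ 2 ∂ρ = 1) {p : ℕ} (A : Matrix (Fin p) (Fin p) ℝ) :
    ∫ x, |x ⬝ᵥ A *ᵥ x - A.trace| ∂(Measure.pi fun _ : Fin p => ρ) ≤
      √((2 * ∫ x, x ^ 4 ∂ρ + 4) * ∑ i, ∑ j, A i j ^ 2) :=
  integral_abs_le_of_integral_sq_le (memLp_quadraticForm h4 A)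
    (integral_quadraticForm_sub_trace_sq_le h4 h1 h2 A)

end QuadraticForms

/-! ### Measurability of the resolvent -/

section Measurability

variable {α ι : Type*} [MeasurableSpace α] [Fintype ι] [DecidableEq ι]

theorem measurable_det_of_entries {M : α → Matrix ι ι ℝ}
    (hM : ∀ i j, Measurable fun a => M a i j) : Measurable fun a => (M a).det := by
  simp only [Matrix.det_apply']
  exact Finset.measurable_fun_sum _ fun σ _ =>
    (Finset.measurable_fun_prod _ fun i _ => hM _ _).const_mul _

theorem measurable_regInv_apply {M : α → Matrix ι ι ℝ}
    (hM : ∀ i j, Measurable fun a => M a i j) (t : ℝ) (i j : ι) :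
    Measurable fun a => regInv (M a) t i j := by
  have hMt : ∀ i j, Measurable fun a => (M a + t • (1 : Matrix ι ι ℝ)) i j := fun i j => by
    simp only [Matrix.add_apply]
    exact (hM i j).add_const _
  simp only [regInv, Matrix.inv_def, Ring.inverse_eq_inv', Matrix.smul_apply, smul_eq_mul,
    Matrix.adjugate_apply]
  refine (measurable_det_of_entries hMt).inv.mul (measurable_det_of_entries fun k l => ?_)
  by_cases h : k = j
  · subst h
    simp only [Matrix.updateRow_self]
    exact measurable_const
  · simp only [Matrix.updateRow_ne h]
    exact hMt k l

theorem measurable_trace_regInv {M : α → Matrix ι ι ℝ}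
    (hM : ∀ i j, Measurable fun a => M a i j) (t : ℝ) :
    Measurable fun a => (regInv (M a) t).trace :=
  Finset.measurable_fun_sum _ fun i _ => measurable_regInv_apply hM t i i

end Measurability

/-! ### The self-consistent equation of a sample covariance matrix -/

section SampleCovariance

/-- The sample covariance matrix `c ∑ᵢ xᵢ xᵢᵀ` with a free normalisation `c`. -/
def sampleCov {p n : ℕ} (c : ℝ) (x : Fin n → Fin p → ℝ) : Matrix (Fin p) (Fin p) ℝ :=
  c • ∑ i, vecMulVec (x i) (x i)

theorem sampleCov_posSemidef {p n : ℕ} {c : ℝ} (hc : 0 ≤ c) (x : Fin n → Fin p → ℝ) :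
    (sampleCov c x).PosSemidef := by
  rw [sampleCov, Finset.smul_sum]
  exact posSemidef_sum _ fun i _ => posSemidef_smul_vecMulVec_self hc (x i)

theorem sampleCov_eq_removeNth_add {p n : ℕ} (c : ℝ) (x : Fin (n + 1) → Fin p → ℝ)
    (i : Fin (n + 1)) :
    sampleCov c x = sampleCov c (i.removeNth x) + c • vecMulVec (x i) (x i) := by
  rw [sampleCov, sampleCov, Fin.sum_univ_succAbove _ i, smul_add, add_comm]
  rfl

theorem measurable_sampleCov_apply {p n : ℕ} (c : ℝ) (k l : Fin p) :
    Measurable fun x : Fin n → Fin p → ℝ => sampleCov c x k l := by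
  simp only [sampleCov, Matrix.smul_apply, Matrix.sum_apply, vecMulVec_apply]
  fun_prop

/-- The trace identity `tr ((B + t) (B + t)⁻¹) = p`, with each `xᵢ · (B + t)⁻¹ xᵢ` expressed
through the resolvent that leaves the `i`-th observation out. -/
theorem sampleCov_trace_identity {p n : ℕ} {c : ℝ} (hc : 0 ≤ c) {t : ℝ} (ht : 0 < t)
    (x : Fin (n + 1) → Fin p → ℝ) :
    t * (regInv (sampleCov c x) t).trace +
      ∑ i, (1 - 1 / (1 + c * (x i ⬝ᵥ regInv (sampleCov c (i.removeNth x)) t *ᵥ x i))) = p := by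
  have hB := sampleCov_posSemidef hc x
  have h : ((sampleCov c x + t • 1) * regInv (sampleCov c x) t).trace = p := by
    rw [mul_regInv hB ht]; simp
  rw [add_mul, trace_add, smul_mul_assoc, one_mul, trace_smul, smul_eq_mul, add_comm] at h
  have htr : ∀ R : Matrix (Fin p) (Fin p) ℝ,
      (sampleCov c x * R).trace = ∑ i, c * (x i ⬝ᵥ R *ᵥ x i) := fun R => by
    rw [sampleCov, smul_mul_assoc, trace_smul, Finset.sum_mul, trace_sum, Finset.smul_sum]
    refine Finset.sum_congr rfl fun i _ => ?_
    rw [smul_eq_mul, vecMulVec_mul, trace_vecMulVec, dotProduct_comm, ← dotProduct_mulVec]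
  rw [← h, htr]
  congr 1
  refine Finset.sum_congr rfl fun i _ => ?_
  rw [← dotProduct_regInv_add_rankOne (sampleCov_posSemidef hc _) hc _ ht,
    ← sampleCov_eq_removeNth_add]

theorem abs_one_div_one_add_sub_le {c u v : ℝ} (hc : 0 ≤ c) (hu : 0 ≤ u) (hv : 0 ≤ v) :
    |1 / (1 + c * u) - 1 / (1 + c * v)| ≤ c * |u - v| := by
  have h1 : 1 ≤ 1 + c * u := by nlinarith [mul_nonneg hc hu]
  have h2 : 1 ≤ 1 + c * v := by nlinarith [mul_nonneg hc hv]
  have h3 : 1 / (1 + c * u) - 1 / (1 + c * v) = -(c * (u - v)) / ((1 + c * u) * (1 + c * v)) := by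
    field_simp; ring
  rw [h3, abs_div, abs_neg, abs_mul, abs_of_nonneg hc,
    abs_of_pos (mul_pos (one_pos.trans_le h1) (one_pos.trans_le h2))]
  exact div_le_self (by positivity) (one_le_mul_of_one_le_of_one_le h1 h2)

/-- The trace of the resolvent satisfies the Marčenko–Pastur equation up to the fluctuations of
the quadratic forms and an `O(1)` rank-one error per observation. -/
theorem abs_sampleCov_self_consistent_le {p n : ℕ} {c : ℝ} (hc : 0 ≤ c) {t : ℝ} (ht : 0 < t)
    (x : Fin (n + 1) → Fin p → ℝ) :
    |t * (regInv (sampleCov c x) t).trace + (n + 1 : ℕ) *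
        (1 - 1 / (1 + c * (regInv (sampleCov c x) t).trace)) - p| ≤
      c * ∑ i, (|x i ⬝ᵥ regInv (sampleCov c (i.removeNth x)) t *ᵥ x i -
        (regInv (sampleCov c (i.removeNth x)) t).trace| + 1 / t) := by
  have h := sampleCov_trace_identity hc ht x
  set T := (regInv (sampleCov c x) t).trace with hT
  have hT0 : 0 ≤ T := trace_regInv_nonneg (sampleCov_posSemidef hc x) ht
  have hsum : t * T + (n + 1 : ℕ) * (1 - 1 / (1 + c * T)) - p =
      ∑ i : Fin (n + 1), (1 / (1 + c * (x i ⬝ᵥ regInv (sampleCov c (i.removeNth x)) t *ᵥ x i)) -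
        1 / (1 + c * T)) := by
    rw [← h, Finset.sum_sub_distrib, Finset.sum_sub_distrib]
    simp only [Finset.sum_const, Finset.card_univ, Fintype.card_fin, nsmul_eq_mul]
    ring
  rw [hsum, Finset.mul_sum]
  refine (Finset.abs_sum_le_sum_abs _ _).trans (Finset.sum_le_sum fun i _ => ?_)
  have hR := sampleCov_posSemidef hc (i.removeNth x)
  refine (abs_one_div_one_add_sub_le hc (dotProduct_regInv_nonneg hR ht _) hT0).trans ?_
  refine mul_le_mul_of_nonneg_left ?_ hc
  have h2 := trace_regInv_sub_add_rankOne hR hc (x i) ht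
  rw [← sampleCov_eq_removeNth_add] at h2
  exact (abs_sub_le _ (regInv (sampleCov c (i.removeNth x)) t).trace _).trans
    (add_le_add le_rfl h2)

variable {ρ : Measure ℝ} [IsProbabilityMeasure ρ]

theorem dotProduct_regInv_le {ι : Type*} [Fintype ι] [DecidableEq ι] {A : Matrix ι ι ℝ}
    (hA : A.PosSemidef) {t : ℝ} (ht : 0 < t) (v : ι → ℝ) :
    v ⬝ᵥ regInv A t *ᵥ v ≤ (v ⬝ᵥ v) / t := by
  have h1 := dotProduct_sq_le v (regInv A t *ᵥ v)
  have h2 := regInv_mulVec_sq_le hA ht v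
  have h3 := dotProduct_self_nonneg_real v
  refine abs_le_of_sq_le_sq' ?_ (by positivity) |>.2
  calc _ ≤ _ := h1
    _ ≤ (v ⬝ᵥ v) * ((v ⬝ᵥ v) / t ^ 2) := mul_le_mul_of_nonneg_left h2 h3
    _ = _ := by ring

theorem integrable_dotProduct_self (h4 : MemLp id 4 ρ) {p n : ℕ} (i : Fin n) :
    Integrable (fun x : Fin n → Fin p → ℝ => x i ⬝ᵥ x i)
      (Measure.pi fun _ => Measure.pi fun _ => ρ) := by
  have h : Integrable (fun v : Fin p → ℝ => v ⬝ᵥ v) (Measure.pi fun _ => ρ) := by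
    simp only [dotProduct, ← sq]
    exact integrable_finsetSum _ fun k _ =>
      ((memLp_eval h4 k).mono_exponent (by norm_num)).integrable_sq
  exact (measurePreserving_eval (fun _ : Fin n => Measure.pi fun _ : Fin p => ρ) i)
    |>.integrable_comp_of_integrable h

/-- Leave-one-out concentration: `xᵢ` is independent of the resolvent without it. -/
theorem integral_abs_leaveOneOut_le (h4 : MemLp id 4 ρ) (h1 : ∫ x, x ∂ρ = 0)
    (h2 : ∫ x, x ^ 2 ∂ρ = 1) {p n : ℕ} {c : ℝ} (hc : 0 ≤ c) {t : ℝ} (ht : 0 < t)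
    (i : Fin (n + 1)) :
    Integrable (fun x : Fin (n + 1) → Fin p → ℝ =>
      |x i ⬝ᵥ regInv (sampleCov c (i.removeNth x)) t *ᵥ x i -
        (regInv (sampleCov c (i.removeNth x)) t).trace|)
      (Measure.pi fun _ => Measure.pi fun _ => ρ) ∧
    ∫ x : Fin (n + 1) → Fin p → ℝ, |x i ⬝ᵥ regInv (sampleCov c (i.removeNth x)) t *ᵥ x i -
        (regInv (sampleCov c (i.removeNth x)) t).trace|
      ∂(Measure.pi fun _ => Measure.pi fun _ => ρ) ≤
      √((2 * ∫ x, x ^ 4 ∂ρ + 4) * p) / t := by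
  have hrem : ∀ k l, Measurable fun x : Fin (n + 1) → Fin p → ℝ =>
      sampleCov c (i.removeNth x) k l := fun k l =>
    (measurable_sampleCov_apply c k l).comp
      (measurable_pi_lambda _ fun j => measurable_pi_apply _)
  have hint : Integrable (fun x : Fin (n + 1) → Fin p → ℝ =>
      |x i ⬝ᵥ regInv (sampleCov c (i.removeNth x)) t *ᵥ x i -
        (regInv (sampleCov c (i.removeNth x)) t).trace|)
      (Measure.pi fun _ => Measure.pi fun _ => ρ) := by
    refine Integrable.mono' (((integrable_dotProduct_self h4 i).div_const t).add
      (integrable_const (p / t : ℝ))) ?_ (Eventually.of_forall fun x => ?_)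
    · refine Measurable.aestronglyMeasurable ?_
      have hm1 := measurable_trace_regInv hrem t
      have hm2 : Measurable fun x : Fin (n + 1) → Fin p → ℝ =>
          x i ⬝ᵥ regInv (sampleCov c (i.removeNth x)) t *ᵥ x i := by
        simp only [dotProduct, mulVec]
        have := measurable_regInv_apply hrem t
        fun_prop
      exact (hm2.sub hm1).abs
    · have hR := sampleCov_posSemidef hc (i.removeNth x)
      have e1 := dotProduct_regInv_nonneg hR ht (x i)
      have e2 := dotProduct_regInv_le hR ht (x i)
      have e3 := trace_regInv_nonneg hR ht
      have e4 := trace_regInv_le hR ht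
      rw [Fintype.card_fin] at e4
      rw [Real.norm_eq_abs, abs_abs, Pi.add_apply, abs_le]
      constructor <;> linarith
  refine ⟨hint, ?_⟩
  rw [integral_pi_insertNth _ i hint]
  set C := 2 * ∫ x, x ^ 4 ∂ρ + 4 with hC
  have hC0 : 0 ≤ C := by
    have : 0 ≤ ∫ x, x ^ 4 ∂ρ := integral_nonneg fun x => by positivity
    rw [hC]; positivity
  have hbound : ∀ r : Fin n → Fin p → ℝ,
      ∫ e, |((i.insertNth e r : Fin (n + 1) → Fin p → ℝ) i) ⬝ᵥ
        regInv (sampleCov c (i.removeNth (i.insertNth e r : Fin (n + 1) → Fin p → ℝ))) t *ᵥ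
          ((i.insertNth e r : Fin (n + 1) → Fin p → ℝ) i) -
        (regInv (sampleCov c (i.removeNth (i.insertNth e r : Fin (n + 1) → Fin p → ℝ))) t).trace|
          ∂(Measure.pi fun _ : Fin p => ρ) ≤ √(C * p) / t := fun r => by
    simp only [Fin.insertNth_apply_same, Fin.removeNth_insertNth]
    refine (integral_abs_quadraticForm_sub_trace_le h4 h1 h2 _).trans ?_
    have hs := sum_regInv_sq_le (sampleCov_posSemidef hc r) ht
    rw [Fintype.card_fin] at hs
    refine (Real.sqrt_le_sqrt (mul_le_mul_of_nonneg_left hs hC0)).trans (le_of_eq ?_)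
    rw [← mul_div_assoc, Real.sqrt_div' _ (by positivity), Real.sqrt_sq ht.le]
  calc _ ≤ ∫ _ : Fin n → Fin p → ℝ, √(C * p) / t
        ∂(Measure.pi fun _ => Measure.pi fun _ : Fin p => ρ) :=
        integral_mono_of_nonneg
          (Eventually.of_forall fun r => integral_nonneg fun e => abs_nonneg _)
          (integrable_const _) (Eventually.of_forall hbound)
    _ = _ := by simp

/-- Stability of the equation `t s + α s / (1 + β s) = 1`: its left-hand side has slope at least
`t` on the half-line `s ≥ 0`. -/
theorem abs_sub_root_le {t α β α₀ β₀ s s₀ : ℝ} (ht : 0 < t) (hα₀ : 0 ≤ α₀) (hβ : 0 ≤ β)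
    (hβ₀ : 0 ≤ β₀) (hs : 0 ≤ s) (hst : s ≤ 1 / t) (hs₀ : 0 ≤ s₀)
    (hroot : t * s₀ + α₀ * s₀ / (1 + β₀ * s₀) = 1) :
    |s - s₀| ≤ (|t * s + α * s / (1 + β * s) - 1| + |α - α₀| / t + α₀ * |β - β₀| / t ^ 2) / t := by
  have p1 : 0 < 1 + β * s := by positivity
  have p2 : 0 < 1 + β₀ * s := by positivity
  have p3 : 0 < 1 + β₀ * s₀ := by positivity
  have hslope : t * |s - s₀| ≤ |t * s + α₀ * s / (1 + β₀ * s) - 1| := by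
    have e : t * s + α₀ * s / (1 + β₀ * s) - 1 =
        (t + α₀ / ((1 + β₀ * s) * (1 + β₀ * s₀))) * (s - s₀) := by
      calc _ = t * s + α₀ * s / (1 + β₀ * s) - (t * s₀ + α₀ * s₀ / (1 + β₀ * s₀)) := by rw [hroot]
        _ = _ := by field_simp; ring
    have hq : 0 ≤ α₀ / ((1 + β₀ * s) * (1 + β₀ * s₀)) := div_nonneg hα₀ (mul_pos p2 p3).le
    rw [e, abs_mul, abs_of_pos (add_pos_of_pos_of_nonneg ht hq)]
    exact mul_le_mul_of_nonneg_right (le_add_of_nonneg_right hq) (abs_nonneg _)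
  have hdiff : |(t * s + α₀ * s / (1 + β₀ * s) - 1) - (t * s + α * s / (1 + β * s) - 1)| ≤
      |α - α₀| / t + α₀ * |β - β₀| / t ^ 2 := by
    have e : (t * s + α₀ * s / (1 + β₀ * s) - 1) - (t * s + α * s / (1 + β * s) - 1) =
        -((α - α₀) * (s / (1 + β * s))) +
          α₀ * (β - β₀) * (s / (1 + β * s) * (s / (1 + β₀ * s))) := by
      field_simp; ring
    have q1 : s / (1 + β * s) ≤ 1 / t :=
      (div_le_self hs (by nlinarith [mul_nonneg hβ hs])).trans hst
    have q2 : s / (1 + β₀ * s) ≤ 1 / t :=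
      (div_le_self hs (by nlinarith [mul_nonneg hβ₀ hs])).trans hst
    have q3 : 0 ≤ s / (1 + β * s) := by positivity
    have q4 : 0 ≤ s / (1 + β₀ * s) := by positivity
    rw [e]
    refine (abs_add_le _ _).trans (add_le_add ?_ ?_)
    · rw [abs_neg, abs_mul, abs_of_nonneg q3, div_eq_mul_one_div |α - α₀|]
      exact mul_le_mul_of_nonneg_left q1 (abs_nonneg _)
    · rw [abs_mul, abs_mul, abs_of_nonneg hα₀, abs_of_nonneg (mul_nonneg q3 q4),
        div_eq_mul_one_div (α₀ * |β - β₀|), sq, ← one_div_mul_one_div]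
      exact mul_le_mul_of_nonneg_left (mul_le_mul q1 q2 q4 (by positivity)) (by positivity)
  rw [le_div_iff₀ ht, mul_comm]
  have h3 := abs_sub_abs_le_abs_sub (t * s + α₀ * s / (1 + β₀ * s) - 1)
    (t * s + α * s / (1 + β * s) - 1)
  linarith

/-- Quantitative Marčenko–Pastur law for the mean: the normalised trace of the resolvent of
`c ∑ᵢ xᵢ xᵢᵀ` is close in `L¹` to the root of the self-consistent equation. -/
theorem integral_abs_trace_sampleCov_sub_le (h4 : MemLp id 4 ρ) (h1 : ∫ x, x ∂ρ = 0)
    (h2 : ∫ x, x ^ 2 ∂ρ = 1) {p n : ℕ} (hp : 0 < p) {c : ℝ} (hc : 0 ≤ c) {t : ℝ} (ht : 0 < t)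
    {α₀ β₀ s₀ : ℝ} (hα₀ : 0 ≤ α₀) (hβ₀ : 0 ≤ β₀) (hs₀ : 0 ≤ s₀)
    (hroot : t * s₀ + α₀ * s₀ / (1 + β₀ * s₀) = 1) :
    ∫ x : Fin (n + 1) → Fin p → ℝ, |(regInv (sampleCov c x) t).trace / p - s₀|
      ∂(Measure.pi fun _ => Measure.pi fun _ => ρ) ≤
      ((c * (n + 1 : ℕ)) / p * (√((2 * ∫ x, x ^ 4 ∂ρ + 4) * p) / t + 1 / t) +
        |c * (n + 1 : ℕ) - α₀| / t + α₀ * |c * p - β₀| / t ^ 2) / t := by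
  have hp' : (0 : ℝ) < p := by exact_mod_cast hp
  set C := 2 * ∫ x, x ^ 4 ∂ρ + 4
  set Q : Fin (n + 1) → (Fin (n + 1) → Fin p → ℝ) → ℝ := fun i x =>
    |x i ⬝ᵥ regInv (sampleCov c (i.removeNth x)) t *ᵥ x i -
        (regInv (sampleCov c (i.removeNth x)) t).trace| with hQ
  have hQi : ∀ i, Integrable (Q i) (Measure.pi fun _ => Measure.pi fun _ => ρ) := fun i =>
    (integral_abs_leaveOneOut_le h4 h1 h2 hc ht i).1
  have hQb : ∀ i, ∫ x, Q i x ∂(Measure.pi fun _ => Measure.pi fun _ => ρ) ≤ √(C * p) / t :=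
    fun i => (integral_abs_leaveOneOut_le h4 h1 h2 hc ht i).2
  have hpt : ∀ x : Fin (n + 1) → Fin p → ℝ, |(regInv (sampleCov c x) t).trace / p - s₀| ≤
      (c / p * ∑ i, (Q i x + 1 / t) + |c * (n + 1 : ℕ) - α₀| / t +
        α₀ * |c * p - β₀| / t ^ 2) / t := fun x => by
    have hB := sampleCov_posSemidef hc x
    have hmain := abs_sampleCov_self_consistent_le hc ht x
    have hT0 := trace_regInv_nonneg hB ht
    have hT1 := trace_regInv_le hB ht
    rw [Fintype.card_fin] at hT1
    set T := (regInv (sampleCov c x) t).trace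
    refine (abs_sub_root_le (s := T / p) (α := c * (n + 1 : ℕ)) (β := c * p) ht hα₀ (by positivity)
      hβ₀ (by positivity) (by rw [div_le_div_iff₀ hp' ht]; rw [le_div_iff₀ ht] at hT1; linarith)
      hs₀ hroot).trans ?_
    gcongr
    have e : t * (T / p) + c * (n + 1 : ℕ) * (T / p) / (1 + c * p * (T / p)) - 1 =
        (t * T + (n + 1 : ℕ) * (1 - 1 / (1 + c * T)) - p) / p := by
      have e1 : c * p * (T / p) = c * T := by field_simp
      have e2 : 1 + c * T ≠ 0 := by positivity
      rw [e1]
      field_simp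
      ring
    rw [e, abs_div, abs_of_pos hp', div_le_iff₀ hp']
    rwa [div_mul_eq_mul_div, div_mul_cancel₀ _ hp'.ne']
  have hS : Integrable (fun x => ∑ i, (Q i x + 1 / t))
      (Measure.pi fun _ => Measure.pi fun _ => ρ) :=
    integrable_finsetSum _ fun i _ => (hQi i).fun_add (integrable_const _)
  calc _ ≤ ∫ x, (c / p * ∑ i, (Q i x + 1 / t) + |c * (n + 1 : ℕ) - α₀| / t +
        α₀ * |c * p - β₀| / t ^ 2) / t ∂(Measure.pi fun _ => Measure.pi fun _ => ρ) :=
        integral_mono_of_nonneg (Eventually.of_forall fun x => abs_nonneg _)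
          ((((hS.const_mul _).fun_add (integrable_const _)).fun_add
            (integrable_const _)).div_const _)
          (Eventually.of_forall hpt)
    _ = (c / p * ∑ i, (∫ x, Q i x ∂(Measure.pi fun _ => Measure.pi fun _ => ρ) + 1 / t) +
        |c * (n + 1 : ℕ) - α₀| / t + α₀ * |c * p - β₀| / t ^ 2) / t := by
        rw [integral_div, integral_add ((hS.const_mul _).fun_add (integrable_const _))
          (integrable_const _), integral_add (hS.const_mul _) (integrable_const _),
          integral_const_mul, integral_finsetSum _ fun i _ => (hQi i).fun_add (integrable_const _)]
        congr 3
        · congr 1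
          congr 1
          ext i
          rw [integral_add (hQi i) (integrable_const _)]
          simp
        · simp
        · simp
    _ ≤ (c / p * ∑ i : Fin (n + 1), (√(C * p) / t + 1 / t) +
        |c * (n + 1 : ℕ) - α₀| / t + α₀ * |c * p - β₀| / t ^ 2) / t := by
        gcongr with i
        exact hQb i
    _ = _ := by
        rw [Finset.sum_const, Finset.card_univ, Fintype.card_fin, nsmul_eq_mul]
        ring

end SampleCovariance

/-! ### The Kendall matrix: comparison and bounded differences -/

section KendallMatrix

/-- The index set of the pairs `i < j`. -/
def pairs (n : ℕ) : Finset (Fin n × Fin n) := Finset.univ.filter fun z => z.1 < z.2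

theorem sum_pairs_eq {M : Type*} [AddCommMonoid M] {n : ℕ} (f : Fin n → Fin n → M) :
    ∑ z ∈ pairs n, f z.1 z.2 = ∑ i, ∑ j ∈ Finset.Ioi i, f i j := by
  rw [pairs, Finset.sum_filter, ← Finset.univ_product_univ, Finset.sum_product]
  refine Finset.sum_congr rfl fun i _ => ?_
  rw [← Finset.sum_filter]
  refine Finset.sum_congr ?_ fun _ _ => rfl
  ext j
  simp

theorem card_pairs_le (n : ℕ) : ((pairs n).card : ℝ) ≤ n * ((n : ℝ) - 1) := by
  have h : ((pairs n).card : ℝ) = ∑ z ∈ pairs n, (1 : ℝ) := by simp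
  rw [h, sum_pairs_eq (fun _ _ => (1 : ℝ))]
  calc _ ≤ ∑ _i : Fin n, ((n : ℝ) - 1) := by
        refine Finset.sum_le_sum fun i _ => ?_
        have : n - 1 - (i : ℕ) + 1 ≤ n := by have := i.2; omega
        have h2 : ((n - 1 - (i : ℕ) : ℕ) : ℝ) + 1 ≤ n := by exact_mod_cast this
        simp only [Finset.sum_const, Fin.card_Ioi, nsmul_eq_mul, mul_one]
        linarith
    _ = _ := by simp; ring

/-- The weighted sum `∑ a_{ij} (xᵢ - xⱼ) (xᵢ - xⱼ)ᵀ` over a set `s` of pairs `(i, j)`. -/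
def pairSum {p n : ℕ} (s : Finset (Fin n × Fin n)) (a : Fin n × Fin n → ℝ)
    (x : Fin n → Fin p → ℝ) :
    Matrix (Fin p) (Fin p) ℝ :=
  ∑ z ∈ s, a z • vecMulVec (x z.1 - x z.2) (x z.1 - x z.2)

theorem pairSum_posSemidef {p n : ℕ} (s : Finset (Fin n × Fin n)) {a : Fin n × Fin n → ℝ}
    (ha : ∀ z, 0 ≤ a z) (x : Fin n → Fin p → ℝ) : (pairSum s a x).PosSemidef :=
  posSemidef_sum _ fun z _ => posSemidef_smul_vecMulVec_self (ha z) _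

/-- The weight of the pair `z` in `½ p K_n`. For `xᵢ = xⱼ` the division by zero gives weight `0`. -/
noncomputable def kendallWeight {p n : ℕ} (x : Fin n → Fin p → ℝ) (z : Fin n × Fin n) : ℝ :=
  (p / (n * ((n : ℝ) - 1))) / ((x z.1 - x z.2) ⬝ᵥ (x z.1 - x z.2))

theorem mul_sub_one_nonneg (n : ℕ) : 0 ≤ (n : ℝ) * ((n : ℝ) - 1) := by
  rcases n.eq_zero_or_pos with rfl | h
  · simp
  · have : (1 : ℝ) ≤ n := by exact_mod_cast h
    exact mul_nonneg (by positivity) (by linarith)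

theorem kendallWeight_nonneg {p n : ℕ} (x : Fin n → Fin p → ℝ) (z : Fin n × Fin n) :
    0 ≤ kendallWeight x z :=
  div_nonneg (div_nonneg (by positivity) (mul_sub_one_nonneg n)) (dotProduct_self_nonneg_real _)

theorem kendallWeight_mul_le {p n : ℕ} (x : Fin n → Fin p → ℝ) (z : Fin n × Fin n) :
    kendallWeight x z * ((x z.1 - x z.2) ⬝ᵥ (x z.1 - x z.2)) ≤ p / (n * ((n : ℝ) - 1)) := by
  have h0 : 0 ≤ (p : ℝ) / (n * ((n : ℝ) - 1)) := div_nonneg (by positivity) (mul_sub_one_nonneg n)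
  unfold kendallWeight
  by_cases h : (x z.1 - x z.2) ⬝ᵥ (x z.1 - x z.2) = 0
  · rw [h, mul_zero]; exact h0
  · rw [div_mul_cancel₀ _ h]

theorem scaledKendallTau_eq_pairSum {p n : ℕ} (x : Fin n → Fin p → ℝ) :
    scaledKendallTau (fun i => WithLp.toLp 2 (x i)) = pairSum (pairs n) (kendallWeight x) x := by
  rw [scaledKendallTau, kendallTau, ← sum_pairs_eq (fun i j =>
    (1 / ‖WithLp.toLp 2 (x i) - WithLp.toLp 2 (x j)‖ ^ 2) • vecMulVec
      (WithLp.toLp 2 (x i) - WithLp.toLp 2 (x j)).ofLp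
      (WithLp.toLp 2 (x i) - WithLp.toLp 2 (x j)).ofLp), Finset.smul_sum, Finset.smul_sum, pairSum]
  refine Finset.sum_congr rfl fun z _ => ?_
  rw [EuclideanSpace.real_norm_sq_eq, smul_smul, smul_smul, kendallWeight]
  simp only [WithLp.ofLp_sub, dotProduct, Pi.sub_apply, ← sq]
  congr 1
  simp only [div_eq_mul_inv]
  ring

/-- Centering: `∑_{i < j} (xᵢ - xⱼ) (xᵢ - xⱼ)ᵀ = n ∑ᵢ xᵢ xᵢᵀ - (∑ᵢ xᵢ) (∑ᵢ xᵢ)ᵀ`. -/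
theorem pairSum_one_add {p n : ℕ} (x : Fin n → Fin p → ℝ) :
    pairSum (pairs n) (fun _ => 1) x + vecMulVec (∑ i, x i) (∑ i, x i) =
      (n : ℝ) • ∑ i, vecMulVec (x i) (x i) := by
  ext k l
  simp only [pairSum, one_smul, Matrix.add_apply, Matrix.sum_apply, vecMulVec_apply,
    Matrix.smul_apply, Finset.sum_apply, Pi.sub_apply, smul_eq_mul]
  rw [sum_pairs_eq (fun i j => (x i k - x j k) * (x i l - x j l))]
  have h := Finset.sum_sum_Ioi_add_eq_sum_sum_off_diag
    (fun i j : Fin n => (x i k - x j k) * (x i l - x j l))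
  have h2 : ∀ i : Fin n, ∑ j ∈ {i}ᶜ, (x j k - x i k) * (x j l - x i l) =
      ∑ j, (x j k - x i k) * (x j l - x i l) := fun i => by
    refine Finset.sum_subset (Finset.subset_univ _) fun j _ hj => ?_
    have : j = i := by simpa using hj
    simp [this]
  have h3 : ∀ i j : Fin n, (x j k - x i k) * (x j l - x i l) + (x i k - x j k) * (x i l - x j l) =
      2 * ((x i k - x j k) * (x i l - x j l)) := fun i j => by ring
  simp only [h2, h3, ← Finset.mul_sum] at h
  have h4 : ∑ i : Fin n, ∑ j, (x j k - x i k) * (x j l - x i l) =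
      2 * (n * ∑ i, x i k * x i l) - 2 * ((∑ i, x i k) * ∑ i, x i l) := by
    simp only [sub_mul, mul_sub, Finset.sum_sub_distrib, ← Finset.mul_sum, ← Finset.sum_mul,
      Finset.sum_const, Finset.card_univ, Fintype.card_fin, nsmul_eq_mul]
    simp only [mul_left_comm _ (n : ℝ), ← Finset.mul_sum]
    ring
  linarith

/-- Replacing the squared distances by their common limit `2p` and then dropping the rank-one
centering term turns `½ p K_n` into a sample covariance matrix. -/
theorem abs_trace_kendall_sub_sampleCov_le {p n : ℕ} (hn : 2 ≤ n) {t : ℝ} (ht : 0 < t)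
    (x : Fin n → Fin p → ℝ) :
    |(regInv (pairSum (pairs n) (kendallWeight x) x) t).trace -
      (regInv (sampleCov (1 / (2 * ((n : ℝ) - 1))) x) t).trace| ≤
      ∑ z ∈ pairs n, 1 / (n * ((n : ℝ) - 1)) *
        |(x z.1 - x z.2) ⬝ᵥ (x z.1 - x z.2) / 2 - p| / t ^ 2 + 1 / t := by
  have hn' : (2 : ℝ) ≤ n := by exact_mod_cast hn
  have hN : 0 < (n : ℝ) * ((n : ℝ) - 1) := mul_pos (by linarith) (by linarith)
  set g : ℝ := 1 / (2 * (n * ((n : ℝ) - 1))) with hg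
  have hg0 : 0 ≤ g := by positivity
  set G := pairSum (pairs n) (fun _ => g) x with hG
  have hK := pairSum_posSemidef (pairs n) (kendallWeight_nonneg x) x
  have hGp : G.PosSemidef := pairSum_posSemidef (pairs n) (fun _ => hg0) x
  have hGS : G + g • vecMulVec (∑ i, x i) (∑ i, x i) = sampleCov (1 / (2 * ((n : ℝ) - 1))) x := by
    have h := congrArg (fun M => g • M) (pairSum_one_add x)
    simp only [smul_add, pairSum, Finset.smul_sum, smul_smul, mul_one] at h
    rw [hG, pairSum, h, sampleCov, Finset.smul_sum]
    refine Finset.sum_congr rfl fun i _ => ?_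
    congr 1
    have : (n : ℝ) - 1 ≠ 0 := by linarith
    rw [hg]; field_simp
  have h1 := abs_trace_regInv_sub_le hK hGp ht (pairs n)
    (fun z => g - kendallWeight x z) (fun z => x z.1 - x z.2) (by
      simp only [hG, pairSum, sub_smul, Finset.sum_sub_distrib])
  have h2 := trace_regInv_sub_add_rankOne hGp hg0 (∑ i, x i) ht
  rw [hGS] at h2
  refine (abs_sub_le _ (regInv G t).trace _).trans (add_le_add (h1.trans ?_) h2)
  refine Finset.sum_le_sum fun z _ => div_le_div_of_nonneg_right ?_ (by positivity)
  rw [kendallWeight]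
  set D := (x z.1 - x z.2) ⬝ᵥ (x z.1 - x z.2) with hD
  have hD0 : 0 ≤ D := dotProduct_self_nonneg_real _
  rcases hD0.eq_or_lt with h | h
  · rw [← h, mul_zero]; positivity
  · rw [← abs_of_pos h, ← abs_mul, abs_of_pos h, ← abs_of_pos (one_div_pos.2 hN), ← abs_mul]
    refine le_of_eq (congrArg _ ?_)
    have : (n : ℝ) - 1 ≠ 0 := by linarith
    rw [hg]
    field_simp

theorem card_pairs_filter_le {n : ℕ} (k : Fin n) :
    ((pairs n).filter fun z => z.1 = k ∨ z.2 = k).card ≤ 2 * n := by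
  have : (pairs n).filter (fun z => z.1 = k ∨ z.2 = k) ⊆
      (Finset.univ.image fun j : Fin n => (k, j)) ∪ Finset.univ.image fun j : Fin n => (j, k) := by
    rintro ⟨a, b⟩ h
    simp only [Finset.mem_filter] at h
    rcases h.2 with h | h
    · subst h; simp
    · subst h; simp
  calc _ ≤ _ := Finset.card_le_card this
    _ ≤ _ := Finset.card_union_le _ _
    _ ≤ n + n := add_le_add (Finset.card_image_le.trans (by simp))
        (Finset.card_image_le.trans (by simp))
    _ = _ := by ring

/-- Deleting the pairs that contain one index `k` moves the trace of the resolvent by `O(p / n)`,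
uniformly in the data: each pair contributes a matrix of trace norm at most `p / (n (n - 1))`. -/
theorem abs_trace_kendall_sub_delete_le {p n : ℕ} (hn : 2 ≤ n) {t : ℝ} (ht : 0 < t)
    (x : Fin n → Fin p → ℝ) (k : Fin n) :
    |(regInv (pairSum (pairs n) (kendallWeight x) x) t).trace -
      (regInv (pairSum ((pairs n).filter fun z => ¬(z.1 = k ∨ z.2 = k)) (kendallWeight x) x)
        t).trace| ≤ p * (4 / (n * t ^ 2)) := by
  have hn' : (2 : ℝ) ≤ n := by exact_mod_cast hn
  have hN : 0 < (n : ℝ) * ((n : ℝ) - 1) := mul_pos (by linarith) (by linarith)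
  have hw := kendallWeight_nonneg x
  have h := abs_trace_regInv_sub_le (pairSum_posSemidef (pairs n) hw x)
    (pairSum_posSemidef ((pairs n).filter fun z => ¬(z.1 = k ∨ z.2 = k)) hw x) ht
    ((pairs n).filter fun z => z.1 = k ∨ z.2 = k)
    (fun z => - kendallWeight x z) (fun z => x z.1 - x z.2) (by
      rw [pairSum, pairSum, ← Finset.sum_filter_add_sum_filter_not (pairs n)
        (fun z => z.1 = k ∨ z.2 = k)]
      simp only [neg_smul, Finset.sum_neg_distrib]
      abel)
  refine h.trans ?_
  calc _ ≤ ∑ z ∈ (pairs n).filter fun z => z.1 = k ∨ z.2 = k,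
        (p / (n * ((n : ℝ) - 1))) / t ^ 2 := by
        refine Finset.sum_le_sum fun z _ => div_le_div_of_nonneg_right ?_ (by positivity)
        rw [abs_neg, abs_of_nonneg (hw z)]
        exact kendallWeight_mul_le x z
    _ ≤ (2 * n : ℕ) * ((p / (n * ((n : ℝ) - 1))) / t ^ 2) := by
        rw [Finset.sum_const, nsmul_eq_mul]
        refine mul_le_mul_of_nonneg_right ?_ (by positivity)
        exact_mod_cast card_pairs_filter_le k
    _ ≤ _ := by
        have h1 : 0 < (n : ℝ) - 1 := by linarith
        have h2 : (2 : ℝ) / (n - 1) ≤ 4 / n := by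
          rw [div_le_div_iff₀ h1 (by linarith)]; linarith
        calc ((2 * n : ℕ) : ℝ) * ((p / (n * ((n : ℝ) - 1))) / t ^ 2)
            = p / t ^ 2 * (2 / ((n : ℝ) - 1)) := by push_cast; field_simp
          _ ≤ p / t ^ 2 * (4 / n) := mul_le_mul_of_nonneg_left h2 (by positivity)
          _ = _ := by field_simp

/-- Changing one observation moves the normalised trace of the resolvent of `½ p K_n` by `O(1/n)`,
whatever the observations are. -/
theorem kendall_bounded_difference {p n : ℕ} (hp : 0 < p) (hn : 2 ≤ n) {t : ℝ} (ht : 0 < t)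
    (x : Fin n → Fin p → ℝ) (k : Fin n) (e : Fin p → ℝ) :
    |(regInv (pairSum (pairs n) (kendallWeight (Function.update x k e)) (Function.update x k e))
        t).trace / p -
      (regInv (pairSum (pairs n) (kendallWeight x) x) t).trace / p| ≤ 8 / (n * t ^ 2) := by
  have hp' : (0 : ℝ) < p := by exact_mod_cast hp
  have h1 := abs_trace_kendall_sub_delete_le hn ht x k
  have h2 := abs_trace_kendall_sub_delete_le hn ht (Function.update x k e) k
  have heq : pairSum ((pairs n).filter fun z => ¬(z.1 = k ∨ z.2 = k))
      (kendallWeight (Function.update x k e)) (Function.update x k e) =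
      pairSum ((pairs n).filter fun z => ¬(z.1 = k ∨ z.2 = k)) (kendallWeight x) x := by
    refine Finset.sum_congr rfl fun z hz => ?_
    have hz' := (Finset.mem_filter.1 hz).2
    push Not at hz'
    simp only [kendallWeight, Function.update_of_ne hz'.1, Function.update_of_ne hz'.2]
  rw [heq] at h2
  rw [← sub_div, abs_div, abs_of_pos hp', div_le_iff₀ hp']
  rw [abs_sub_comm] at h1
  refine (abs_sub_le _ _ _).trans ((add_le_add h2 h1).trans (le_of_eq ?_))
  ring

theorem measurable_kendall_apply {p n : ℕ} (k l : Fin p) :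
    Measurable fun x : Fin n → Fin p → ℝ => pairSum (pairs n) (kendallWeight x) x k l := by
  simp only [pairSum, kendallWeight, Matrix.sum_apply, Matrix.smul_apply, vecMulVec_apply,
    dotProduct, Pi.sub_apply, smul_eq_mul]
  fun_prop

end KendallMatrix

/-! ### The mean Stieltjes transform of the Kendall matrix -/

section KendallMean

variable {ρ : Measure ℝ} [IsProbabilityMeasure ρ]

/-- The half squared distance of two independent observations concentrates around `p`. -/
theorem integral_abs_half_dist_sq_sub_le (h4 : MemLp id 4 ρ) (h1 : ∫ x, x ∂ρ = 0)
    (h2 : ∫ x, x ^ 2 ∂ρ = 1) {p n : ℕ} {i j : Fin n} (hij : i ≠ j) :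
    Integrable (fun x : Fin n → Fin p → ℝ => |(x i - x j) ⬝ᵥ (x i - x j) / 2 - p|)
      (Measure.pi fun _ => Measure.pi fun _ => ρ) ∧
    ∫ x : Fin n → Fin p → ℝ, |(x i - x j) ⬝ᵥ (x i - x j) / 2 - p|
      ∂(Measure.pi fun _ => Measure.pi fun _ => ρ) ≤
      √((2 * ∫ x, x ^ 4 ∂ρ + 4) * p) + √p := by
  obtain ⟨n, rfl⟩ : ∃ m, n = m + 1 := ⟨n - 1, by have := i.2; omega⟩
  set P := Measure.pi fun _ : Fin p => ρ with hP
  set C := 2 * ∫ x, x ^ 4 ∂ρ + 4 with hC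
  -- one observation: the squared norm is the quadratic form of the identity
  have hN2 : MemLp (fun v : Fin p → ℝ => v ⬝ᵥ v - p) 2 P := by
    simpa using memLp_quadraticForm h4 (1 : Matrix (Fin p) (Fin p) ℝ)
  have hN : ∫ v : Fin p → ℝ, |v ⬝ᵥ v - p| ∂P ≤ √(C * p) := by
    have h := integral_abs_quadraticForm_sub_trace_le h4 h1 h2 (1 : Matrix (Fin p) (Fin p) ℝ)
    have hs : ∑ i : Fin p, ∑ j : Fin p, (1 : Matrix (Fin p) (Fin p) ℝ) i j ^ 2 = p := by
      simp [Matrix.one_apply]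
    rw [hs] at h
    simpa using h
  have hmpi := fun i : Fin (n + 1) => measurePreserving_eval (fun _ : Fin (n + 1) => P) i
  have hNi : ∀ i : Fin (n + 1), Integrable (fun x : Fin (n + 1) → Fin p → ℝ => |x i ⬝ᵥ x i - p|)
      (Measure.pi fun _ => P) := fun i =>
    (hmpi i).integrable_comp_of_integrable (hN2.integrable (by norm_num)).abs
  have hNb : ∀ i : Fin (n + 1), ∫ x : Fin (n + 1) → Fin p → ℝ, |x i ⬝ᵥ x i - p|
      ∂(Measure.pi fun _ => P) ≤ √(C * p) := fun i => by
    refine le_trans (le_of_eq ?_) hN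
    have := integral_map (μ := Measure.pi fun _ : Fin (n + 1) => P) (hmpi i).measurable.aemeasurable
      (f := fun v : Fin p → ℝ => |v ⬝ᵥ v - p|)
      (by rw [(hmpi i).map_eq]; exact (hN2.integrable (by norm_num)).abs.aestronglyMeasurable)
    rw [(hmpi i).map_eq] at this
    exact this.symm
  -- the cross term
  have hcm : Measurable fun x : Fin (n + 1) → Fin p → ℝ => x i ⬝ᵥ x j := by
    simp only [dotProduct]; fun_prop
  have hSi := fun i : Fin (n + 1) => integrable_dotProduct_self (p := p) h4 i
  have hci : Integrable (fun x : Fin (n + 1) → Fin p → ℝ => |x i ⬝ᵥ x j|)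
      (Measure.pi fun _ => P) := by
    refine Integrable.mono' ((hSi i).fun_add (hSi j)) hcm.abs.aestronglyMeasurable
      (Eventually.of_forall fun x => ?_)
    rw [Real.norm_eq_abs, abs_abs]
    have e1 := dotProduct_self_nonneg_real (x i)
    have e2 := dotProduct_self_nonneg_real (x j)
    refine abs_le_of_sq_le_sq ?_ (by positivity)
    have := dotProduct_sq_le (x i) (x j)
    nlinarith
  have hcb : ∫ x : Fin (n + 1) → Fin p → ℝ, |x i ⬝ᵥ x j| ∂(Measure.pi fun _ => P) ≤ √p := by
    rw [integral_pi_insertNth P i hci]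
    obtain ⟨j', rfl⟩ := Fin.exists_succAbove_eq hij.symm
    simp only [Fin.insertNth_apply_same, Fin.insertNth_apply_succAbove]
    have hb : ∀ r : Fin n → Fin p → ℝ, ∫ e, |e ⬝ᵥ r j'| ∂P ≤ √(r j' ⬝ᵥ r j') := fun r => by
      have hf : MemLp (fun e : Fin p → ℝ => e ⬝ᵥ r j') 2 P := by
        simp only [dotProduct_comm _ (r j')]
        exact memLp_dotProduct h4 (r j')
      refine integral_abs_le_of_integral_sq_le hf (le_of_eq ?_)
      simp only [dotProduct_comm _ (r j')]
      exact integral_dotProduct_sq h4 h1 h2 (r j')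
    have hS := integrable_dotProduct_self (p := p) h4 j'
    have hsm : Measurable fun r : Fin n → Fin p → ℝ => √(r j' ⬝ᵥ r j') := by
      simp only [dotProduct]; fun_prop
    have hmem : MemLp (fun r : Fin n → Fin p → ℝ => √(r j' ⬝ᵥ r j')) 2
        (Measure.pi fun _ => P) := by
      rw [memLp_two_iff_integrable_sq hsm.aestronglyMeasurable]
      refine hS.congr (Eventually.of_forall fun r => ?_)
      simp only
      rw [Real.sq_sqrt (dotProduct_self_nonneg_real _)]
    have hnorm : ∫ r : Fin n → Fin p → ℝ, √(r j' ⬝ᵥ r j') ^ 2 ∂(Measure.pi fun _ => P) ≤ p := by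
      simp only [Real.sq_sqrt (dotProduct_self_nonneg_real _)]
      simp only [dotProduct, ← sq]
      obtain ⟨-, i2, -⟩ := integrable_pow_of_memLp_four h4
      have hk : ∀ k : Fin p, Integrable (fun r : Fin n → Fin p → ℝ => r j' k ^ 2)
          (Measure.pi fun _ => P) ∧
          ∫ r : Fin n → Fin p → ℝ, r j' k ^ 2 ∂(Measure.pi fun _ => P) = 1 := fun k => by
        have hmp := (measurePreserving_eval (fun _ : Fin p => ρ) k).comp
          (measurePreserving_eval (fun _ : Fin n => P) j')
        refine ⟨hmp.integrable_comp_of_integrable i2, ?_⟩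
        have := integral_map (μ := Measure.pi fun _ : Fin n => P) hmp.measurable.aemeasurable
          (f := fun v : ℝ => v ^ 2) (by rw [hmp.map_eq]; exact i2.aestronglyMeasurable)
        rw [hmp.map_eq, h2] at this
        exact this.symm
      rw [integral_finsetSum _ fun k _ => (hk k).1]
      simp [(hk _).2]
    calc _ ≤ ∫ r : Fin n → Fin p → ℝ, √(r j' ⬝ᵥ r j') ∂(Measure.pi fun _ => P) :=
          integral_mono_of_nonneg
            (Eventually.of_forall fun r => integral_nonneg fun e => abs_nonneg _)
            (hmem.integrable (by norm_num)) (Eventually.of_forall hb)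
      _ = ∫ r : Fin n → Fin p → ℝ, |√(r j' ⬝ᵥ r j')| ∂(Measure.pi fun _ => P) := by
          simp only [abs_of_nonneg (Real.sqrt_nonneg _)]
      _ ≤ √p := integral_abs_le_of_integral_sq_le hmem hnorm
  have hpt : ∀ x : Fin (n + 1) → Fin p → ℝ, |(x i - x j) ⬝ᵥ (x i - x j) / 2 - p| ≤
      1 / 2 * |x i ⬝ᵥ x i - p| + 1 / 2 * |x j ⬝ᵥ x j - p| + |x i ⬝ᵥ x j| := fun x => by
    have e : (x i - x j) ⬝ᵥ (x i - x j) / 2 - p =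
        1 / 2 * (x i ⬝ᵥ x i - p) + 1 / 2 * (x j ⬝ᵥ x j - p) - x i ⬝ᵥ x j := by
      rw [sub_dotProduct, dotProduct_sub, dotProduct_sub, dotProduct_comm (x j) (x i)]
      ring
    rw [e]
    refine (abs_sub _ _).trans (add_le_add ((abs_add_le _ _).trans (le_of_eq ?_)) le_rfl)
    rw [abs_mul, abs_mul, abs_of_pos (by norm_num : (0 : ℝ) < 1 / 2)]
  have hri : Integrable (fun x : Fin (n + 1) → Fin p → ℝ =>
      1 / 2 * |x i ⬝ᵥ x i - p| + 1 / 2 * |x j ⬝ᵥ x j - p| + |x i ⬝ᵥ x j|)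
      (Measure.pi fun _ => P) :=
    (((hNi i).const_mul _).fun_add ((hNi j).const_mul _)).fun_add hci
  refine ⟨Integrable.mono' hri ?_ (Eventually.of_forall fun x => ?_), ?_⟩
  · refine Measurable.aestronglyMeasurable ?_
    simp only [dotProduct, Pi.sub_apply]
    fun_prop
  · rw [Real.norm_eq_abs, abs_abs]; exact hpt x
  · calc _ ≤ ∫ x : Fin (n + 1) → Fin p → ℝ,
          (1 / 2 * |x i ⬝ᵥ x i - p| + 1 / 2 * |x j ⬝ᵥ x j - p| + |x i ⬝ᵥ x j|)
          ∂(Measure.pi fun _ => P) :=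
          integral_mono_of_nonneg (Eventually.of_forall fun x => abs_nonneg _) hri
            (Eventually.of_forall hpt)
      _ = 1 / 2 * ∫ x : Fin (n + 1) → Fin p → ℝ, |x i ⬝ᵥ x i - p| ∂(Measure.pi fun _ => P) +
          1 / 2 * ∫ x : Fin (n + 1) → Fin p → ℝ, |x j ⬝ᵥ x j - p| ∂(Measure.pi fun _ => P) +
          ∫ x : Fin (n + 1) → Fin p → ℝ, |x i ⬝ᵥ x j| ∂(Measure.pi fun _ => P) := by
          rw [integral_add (((hNi i).const_mul _).fun_add ((hNi j).const_mul _)) hci,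
            integral_add ((hNi i).const_mul _) ((hNi j).const_mul _), integral_const_mul,
            integral_const_mul]
      _ ≤ _ := by linarith [hNb i, hNb j]

/-- Quantitative convergence in mean of the Stieltjes transform of `½ p K_n`. -/
theorem integral_abs_trace_kendall_sub_le (h4 : MemLp id 4 ρ) (h1 : ∫ x, x ∂ρ = 0)
    (h2 : ∫ x, x ^ 2 ∂ρ = 1) {p n : ℕ} (hp : 0 < p) (hn : 2 ≤ n) {t : ℝ} (ht : 0 < t)
    {β₀ s₀ : ℝ} (hβ₀ : 0 ≤ β₀) (hs₀ : 0 ≤ s₀)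
    (hroot : t * s₀ + 1 / 2 * s₀ / (1 + β₀ * s₀) = 1) :
    ∫ x : Fin n → Fin p → ℝ, |(regInv (pairSum (pairs n) (kendallWeight x) x) t).trace / p - s₀|
      ∂(Measure.pi fun _ => Measure.pi fun _ => ρ) ≤
      ((√((2 * ∫ x, x ^ 4 ∂ρ + 4) * p) + √p) / t ^ 2 + 1 / t) / p +
      ((1 / (2 * ((n : ℝ) - 1)) * n) / p * (√((2 * ∫ x, x ^ 4 ∂ρ + 4) * p) / t + 1 / t) +
        |1 / (2 * ((n : ℝ) - 1)) * n - 1 / 2| / t +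
        1 / 2 * |1 / (2 * ((n : ℝ) - 1)) * p - β₀| / t ^ 2) / t := by
  obtain ⟨n, rfl⟩ : ∃ m, n = m + 1 := ⟨n - 1, by omega⟩
  have hp' : (0 : ℝ) < p := by exact_mod_cast hp
  have hn' : (2 : ℝ) ≤ (n + 1 : ℕ) := by exact_mod_cast hn
  have hN : 0 < ((n + 1 : ℕ) : ℝ) * (((n + 1 : ℕ) : ℝ) - 1) := mul_pos (by linarith) (by linarith)
  set N : ℝ := ((n + 1 : ℕ) : ℝ) * (((n + 1 : ℕ) : ℝ) - 1) with hNdef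
  set c : ℝ := 1 / (2 * (((n + 1 : ℕ) : ℝ) - 1)) with hcdef
  have hc : 0 ≤ c := by
    have : 0 < ((n + 1 : ℕ) : ℝ) - 1 := by linarith
    positivity
  set P := Measure.pi fun _ : Fin (n + 1) => Measure.pi fun _ : Fin p => ρ with hP
  set E := √((2 * ∫ x, x ^ 4 ∂ρ + 4) * p) + √p with hE
  have hcov := integral_abs_trace_sampleCov_sub_le (n := n) h4 h1 h2 hp hc ht
    (by norm_num : (0 : ℝ) ≤ 1 / 2) hβ₀ hs₀ hroot
  set D : Fin (n + 1) × Fin (n + 1) → (Fin (n + 1) → Fin p → ℝ) → ℝ := fun z x =>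
    |(x z.1 - x z.2) ⬝ᵥ (x z.1 - x z.2) / 2 - p| with hD
  have hne : ∀ z ∈ pairs (n + 1), z.1 ≠ z.2 := fun z hz => (Finset.mem_filter.1 hz).2.ne
  have hDi : ∀ z ∈ pairs (n + 1), Integrable (D z) P := fun z hz =>
    (integral_abs_half_dist_sq_sub_le h4 h1 h2 (hne z hz)).1
  have hDb : ∀ z ∈ pairs (n + 1), ∫ x, D z x ∂P ≤ E := fun z hz =>
    (integral_abs_half_dist_sq_sub_le h4 h1 h2 (hne z hz)).2
  have hSi : Integrable (fun x => ∑ z ∈ pairs (n + 1), 1 / N * D z x / t ^ 2) P :=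
    integrable_finsetSum _ fun z hz => ((hDi z hz).const_mul _).div_const _
  have hSb : ∫ x, ∑ z ∈ pairs (n + 1), 1 / N * D z x / t ^ 2 ∂P ≤ E / t ^ 2 := by
    rw [integral_finsetSum _ fun z hz => ((hDi z hz).const_mul _).div_const _]
    simp only [integral_div, integral_const_mul]
    have hE0 : 0 ≤ E := by positivity
    calc _ ≤ ∑ z ∈ pairs (n + 1), 1 / N * E / t ^ 2 := by
          refine Finset.sum_le_sum fun z hz => ?_
          have := hDb z hz
          gcongr
      _ = ((pairs (n + 1)).card : ℝ) * (1 / N * E / t ^ 2) := by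
          rw [Finset.sum_const, nsmul_eq_mul]
      _ ≤ N * (1 / N * E / t ^ 2) :=
          mul_le_mul_of_nonneg_right (card_pairs_le (n + 1)) (by positivity)
      _ = E / t ^ 2 := by field_simp
  have hTi : Integrable (fun x : Fin (n + 1) → Fin p → ℝ =>
      |(regInv (sampleCov c x) t).trace / p - s₀|) P := by
    refine (Integrable.sub ?_ (integrable_const _)).abs
    refine integrable_of_abs_le (M := p / t / p)
      ((measurable_trace_regInv (measurable_sampleCov_apply c) t).div_const _) fun x => ?_
    have hB := sampleCov_posSemidef hc x
    have hT1 := trace_regInv_le hB ht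
    rw [Fintype.card_fin] at hT1
    rw [abs_of_nonneg (div_nonneg (trace_regInv_nonneg hB ht) hp'.le)]
    gcongr
  have hpt : ∀ x : Fin (n + 1) → Fin p → ℝ,
      |(regInv (pairSum (pairs (n + 1)) (kendallWeight x) x) t).trace / p - s₀| ≤
      (∑ z ∈ pairs (n + 1), 1 / N * D z x / t ^ 2 + 1 / t) / p +
        |(regInv (sampleCov c x) t).trace / p - s₀| := fun x => by
    refine (abs_sub_le _ ((regInv (sampleCov c x) t).trace / p) _).trans (add_le_add ?_ le_rfl)
    rw [← sub_div, abs_div, abs_of_pos hp']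
    exact div_le_div_of_nonneg_right (abs_trace_kendall_sub_sampleCov_le hn ht x) hp'.le
  calc _ ≤ ∫ x, ((∑ z ∈ pairs (n + 1), 1 / N * D z x / t ^ 2 + 1 / t) / p +
        |(regInv (sampleCov c x) t).trace / p - s₀|) ∂P :=
        integral_mono_of_nonneg (Eventually.of_forall fun x => abs_nonneg _)
          (((hSi.fun_add (integrable_const _)).div_const _).fun_add hTi) (Eventually.of_forall hpt)
    _ = (∫ x, ∑ z ∈ pairs (n + 1), 1 / N * D z x / t ^ 2 ∂P + 1 / t) / p +
        ∫ x, |(regInv (sampleCov c x) t).trace / p - s₀| ∂P := by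
        rw [integral_add ((hSi.fun_add (integrable_const _)).div_const _) hTi, integral_div,
          integral_add hSi (integrable_const _)]
        simp
    _ ≤ _ := by
        refine add_le_add ?_ hcov
        gcongr

end KendallMean

/-! ### The Marčenko–Pastur law -/

section MarchenkoPastur

/-- The antiderivative is `√(1-u²) + c arcsin u - √(c²-1) arcsin ((1+cu)/(u+c))`. -/
theorem integral_sqrt_one_sub_sq_div {c : ℝ} (hc : 1 < c) :
    IntervalIntegrable (fun u => √(1 - u ^ 2) / (u + c)) volume (-1) 1 ∧
    ∫ u in (-1 : ℝ)..1, √(1 - u ^ 2) / (u + c) = Real.pi * (c - √(c ^ 2 - 1)) := by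
  have hint : IntervalIntegrable (fun u => √(1 - u ^ 2) / (u + c)) volume (-1) 1 := by
    apply ContinuousOn.intervalIntegrable
    apply ContinuousOn.div (by fun_prop) (by fun_prop)
    intro u hu
    rw [Set.uIcc_of_le (by norm_num)] at hu
    linarith [hu.1]
  refine ⟨hint, ?_⟩
  have hc2 : 0 < c ^ 2 - 1 := by nlinarith
  set F : ℝ → ℝ := fun u => √(1 - u ^ 2) + c * Real.arcsin u -
    √(c ^ 2 - 1) * Real.arcsin ((1 + c * u) / (u + c)) with hF
  have hcont : ContinuousOn F (Set.Icc (-1) 1) := by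
    have h1 : ContinuousOn (fun u : ℝ => (1 + c * u) / (u + c)) (Set.Icc (-1) 1) :=
      ContinuousOn.div (by fun_prop) (by fun_prop) fun u hu => by linarith [hu.1]
    have h2 := Real.continuous_arcsin.comp_continuousOn h1
    have h3 := Real.continuous_arcsin
    exact ContinuousOn.sub (by fun_prop) (continuousOn_const.mul h2)
  have hderiv : ∀ u ∈ Set.Ioo (-1 : ℝ) 1, HasDerivAt F (√(1 - u ^ 2) / (u + c)) u := by
    intro u hu
    have hu1 : 0 < 1 - u ^ 2 := by nlinarith [hu.1, hu.2]
    have huc : 0 < u + c := by linarith [hu.1]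
    have hs := Real.sq_sqrt hu1.le
    have hspos := Real.sqrt_pos.2 hu1
    have hcs := Real.sq_sqrt hc2.le
    have hcpos := Real.sqrt_pos.2 hc2
    have d1 : HasDerivAt (fun u : ℝ => √(1 - u ^ 2)) (-u / √(1 - u ^ 2)) u := by
      have := ((hasDerivAt_pow 2 u).const_sub 1).sqrt hu1.ne'
      convert this using 1
      field_simp
      norm_num
      ring
    have d2 : HasDerivAt Real.arcsin (1 / √(1 - u ^ 2)) u :=
      Real.hasDerivAt_arcsin hu.1.ne' hu.2.ne
    have d3 : HasDerivAt (fun u : ℝ => (1 + c * u) / (u + c)) ((c ^ 2 - 1) / (u + c) ^ 2) u := by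
      have := (((hasDerivAt_id u).const_mul c).const_add 1).div
        ((hasDerivAt_id u).add_const c) huc.ne'
      refine HasDerivAt.congr_deriv this ?_
      congr 1
      simp only [id]
      ring
    have hg : 1 - ((1 + c * u) / (u + c)) ^ 2 = (√(c ^ 2 - 1) * √(1 - u ^ 2) / (u + c)) ^ 2 := by
      rw [div_pow, div_pow, mul_pow, hs, hcs]
      field_simp
      ring
    have hgs : √(1 - ((1 + c * u) / (u + c)) ^ 2) = √(c ^ 2 - 1) * √(1 - u ^ 2) / (u + c) := by
      rw [hg, Real.sqrt_sq (by positivity)]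
    have hlt : 0 < 1 - ((1 + c * u) / (u + c)) ^ 2 := by rw [hg]; positivity
    have d4 := (Real.hasDerivAt_arcsin (x := (1 + c * u) / (u + c))
      (by intro h; rw [h] at hlt; norm_num at hlt)
      (by intro h; rw [h] at hlt; norm_num at hlt)).comp u d3
    rw [hgs] at d4
    refine ((d1.add (d2.const_mul c)).sub (d4.const_mul √(c ^ 2 - 1))).congr_deriv ?_
    set s := √(1 - u ^ 2)
    set k := √(c ^ 2 - 1)
    rw [← hcs]
    field_simp
    rw [hcs, hs]
    ring
  rw [intervalIntegral.integral_eq_sub_of_hasDerivAt_of_le (by norm_num) hcont hderiv hint]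
  have e1 : (1 + c * 1) / (1 + c) = 1 := by rw [mul_one]; exact div_self (by linarith)
  have e2 : (1 + c * -1) / (-1 + c) = -1 := by
    rw [div_eq_iff (by linarith)]; ring
  simp only [hF, e1, e2, Real.arcsin_neg, Real.arcsin_one]
  norm_num
  ring

/-- The substitution `x = (a+b)/2 + u (b-a)/2` reduces the integral to `[-1, 1]`. -/
theorem integral_sqrt_mul_div {a b t : ℝ} (hab : a < b) (hat : 0 < a + t) :
    IntervalIntegrable (fun x => √((b - x) * (x - a)) / (x + t)) volume a b ∧
    ∫ x in a..b, √((b - x) * (x - a)) / (x + t) =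
      Real.pi * ((a + b) / 2 + t - √((a + t) * (b + t))) := by
  refine ⟨?_, ?_⟩
  · apply ContinuousOn.intervalIntegrable
    apply ContinuousOn.div (by fun_prop) (by fun_prop)
    intro u hu
    rw [Set.uIcc_of_le hab.le] at hu
    linarith [hu.1]
  set r := (b - a) / 2 with hr
  have hrpos : 0 < r := by rw [hr]; linarith
  set c := ((a + b) / 2 + t) / r with hcd
  have hc : 1 < c := by rw [hcd, lt_div_iff₀ hrpos, hr]; linarith
  have h := (integral_sqrt_one_sub_sq_div hc).2
  have hsub := intervalIntegral.smul_integral_comp_add_mul (a := -1) (b := 1)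
    (fun x => √((b - x) * (x - a)) / (x + t)) r ((a + b) / 2)
  have hl : (a + b) / 2 + r * -1 = a := by rw [hr]; ring
  have hu : (a + b) / 2 + r * 1 = b := by rw [hr]; ring
  rw [hl, hu] at hsub
  rw [← hsub]
  have hfun : ∀ u : ℝ, √((b - ((a + b) / 2 + r * u)) * ((a + b) / 2 + r * u - a)) /
      ((a + b) / 2 + r * u + t) = √(1 - u ^ 2) / (u + c) := fun u => by
    have h1 : (b - ((a + b) / 2 + r * u)) * ((a + b) / 2 + r * u - a) = r ^ 2 * (1 - u ^ 2) := by
      rw [hr]; ring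
    have h2 : (a + b) / 2 + r * u + t = r * (u + c) := by
      rw [hcd]; field_simp; ring
    rw [h1, h2, Real.sqrt_mul (by positivity), Real.sqrt_sq hrpos.le,
      mul_div_mul_left _ _ hrpos.ne']
  simp_rw [hfun]
  rw [h, smul_eq_mul]
  have h3 : (a + t) * (b + t) = r ^ 2 * (c ^ 2 - 1) := by
    rw [hcd]; field_simp; rw [hr]; ring
  rw [h3, Real.sqrt_mul (by positivity), Real.sqrt_sq hrpos.le, hcd]
  field_simp

theorem mpLeft_pos {y v : ℝ} (hy1 : y < 1) (hv : 0 < v) : 0 < mpLeft y v := by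
  have : √y < 1 := by rw [Real.sqrt_lt' one_pos]; simpa using hy1
  have : 0 < 1 - √y := by linarith
  unfold mpLeft
  positivity

theorem mpLeft_lt_mpRight {y v : ℝ} (hy0 : 0 < y) (hv : 0 < v) : mpLeft y v < mpRight y v := by
  have := Real.sqrt_pos.2 hy0
  unfold mpLeft mpRight
  nlinarith [mul_pos hv this]

theorem mpLeft_add_mpRight {y v : ℝ} (hy0 : 0 ≤ y) :
    mpLeft y v + mpRight y v = 2 * v * (1 + y) := by
  have := Real.sq_sqrt hy0
  unfold mpLeft mpRight
  linear_combination (2 * v) * this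

theorem mpLeft_mul_mpRight {y v : ℝ} (hy0 : 0 ≤ y) :
    mpLeft y v * mpRight y v = (v * (1 - y)) ^ 2 := by
  have := Real.sq_sqrt hy0
  unfold mpLeft mpRight
  rw [show v * (1 - √y) ^ 2 * (v * (1 + √y) ^ 2) = (v * (1 - √y ^ 2)) ^ 2 by ring, this]

theorem mpDensity_eq_indicator (y v : ℝ) : mpDensity y v =
    (Set.Icc (mpLeft y v) (mpRight y v)).indicator (fun x =>
      1 / (2 * Real.pi * x * y * v) * √((mpRight y v - x) * (x - mpLeft y v))) := by
  ext x
  simp [mpDensity, Set.indicator_apply]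

theorem measurable_mpDensity (y v : ℝ) : Measurable (mpDensity y v) := by
  rw [mpDensity_eq_indicator]
  exact Measurable.indicator (by fun_prop) measurableSet_Icc

theorem mpDensity_nonneg {y v : ℝ} (hy0 : 0 < y) (hy1 : y < 1) (hv : 0 < v) (x : ℝ) :
    0 ≤ mpDensity y v x := by
  unfold mpDensity
  split_ifs with h
  · have := (mpLeft_pos hy1 hv).trans_le h.1
    positivity
  · exact le_rfl

/-- Integration against the Marčenko–Pastur density is interval integration. -/
theorem integral_mul_mpDensity {y v : ℝ} (hy0 : 0 < y) (hv : 0 < v) (g : ℝ → ℝ) :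
    ∫ x, g x * mpDensity y v x = 1 / (2 * Real.pi * y * v) *
      ∫ x in (mpLeft y v)..(mpRight y v),
        g x * (√((mpRight y v - x) * (x - mpLeft y v)) / (x + 0)) := by
  rw [intervalIntegral.integral_of_le (mpLeft_lt_mpRight hy0 hv).le, ← integral_const_mul,
    ← integral_Icc_eq_integral_Ioc, ← integral_indicator measurableSet_Icc]
  congr 1
  ext x
  rw [mpDensity_eq_indicator]
  by_cases hx : x ∈ Set.Icc (mpLeft y v) (mpRight y v)
  · simp only [Set.indicator_of_mem hx, add_zero]
    simp only [div_eq_mul_inv, mul_inv]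
    ring
  · simp [Set.indicator_of_notMem hx]

theorem integrable_mpDensity {y v : ℝ} (hy0 : 0 < y) (hy1 : y < 1) (hv : 0 < v) :
    Integrable (mpDensity y v) := by
  rw [mpDensity_eq_indicator, integrable_indicator_iff measurableSet_Icc]
  apply ContinuousOn.integrableOn_compact isCompact_Icc
  refine ContinuousOn.mul (ContinuousOn.div continuousOn_const (by fun_prop) fun x hx => ?_)
    (by fun_prop)
  have := (mpLeft_pos hy1 hv).trans_le hx.1
  have := Real.pi_pos
  positivity

theorem integral_mpDensity {y v : ℝ} (hy0 : 0 < y) (hy1 : y < 1) (hv : 0 < v) :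
    ∫ x, mpDensity y v x = 1 := by
  have h := integral_mul_mpDensity hy0 hv (fun _ => 1)
  simp only [one_mul] at h
  rw [h, (integral_sqrt_mul_div (mpLeft_lt_mpRight hy0 hv)
    (by simpa using mpLeft_pos hy1 hv)).2, mpLeft_add_mpRight hy0.le, add_zero, add_zero, add_zero,
    mpLeft_mul_mpRight hy0.le, Real.sqrt_sq (by nlinarith)]
  have := Real.pi_pos
  field_simp
  ring

theorem isProbabilityMeasure_mpLaw {y v : ℝ} (hy0 : 0 < y) (hy1 : y < 1) (hv : 0 < v) :
    IsProbabilityMeasure (mpLaw y v) := by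
  constructor
  rw [mpLaw, withDensity_apply _ MeasurableSet.univ, Measure.restrict_univ,
    ← ofReal_integral_eq_lintegral_ofReal (integrable_mpDensity hy0 hy1 hv)
      (Eventually.of_forall (mpDensity_nonneg hy0 hy1 hv)), integral_mpDensity hy0 hy1 hv,
    ENNReal.ofReal_one]

theorem mpLaw_compl_Icc (y v : ℝ) :
    mpLaw y v (Set.Icc (mpLeft y v) (mpRight y v))ᶜ = 0 := by
  rw [mpLaw, withDensity_apply _ measurableSet_Icc.compl]
  refine (setLIntegral_congr_fun measurableSet_Icc.compl fun x hx => ?_).trans lintegral_zero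
  rw [mpDensity_eq_indicator, Set.indicator_of_notMem hx, ENNReal.ofReal_zero]

theorem integral_mpLaw {y v : ℝ} (hy0 : 0 < y) (hy1 : y < 1) (hv : 0 < v) (g : ℝ → ℝ) :
    ∫ x, g x ∂mpLaw y v = ∫ x, g x * mpDensity y v x := by
  rw [mpLaw, integral_withDensity_eq_integral_toReal_smul
    (measurable_mpDensity y v).ennreal_ofReal (Eventually.of_forall fun _ => ENNReal.ofReal_lt_top)]
  refine integral_congr_ae (Eventually.of_forall fun x => ?_)
  simp only [smul_eq_mul]
  rw [ENNReal.toReal_ofReal (mpDensity_nonneg hy0 hy1 hv x), mul_comm]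

/-- The Stieltjes transform of the Marčenko–Pastur law on the negative half-axis, from the
partial fractions `1 / (x (x + t)) = (1 / x - 1 / (x + t)) / t`. -/
theorem integral_inv_add_mpLaw {y v : ℝ} (hy0 : 0 < y) (hy1 : y < 1) (hv : 0 < v) {t : ℝ}
    (ht : 0 < t) :
    ∫ x, 1 / (x + t) ∂mpLaw y v =
      (√((mpLeft y v + t) * (mpRight y v + t)) - t - v * (1 - y)) / (2 * y * v * t) := by
  rw [integral_mpLaw hy0 hy1 hv, integral_mul_mpDensity hy0 hv]
  have ha := mpLeft_pos hy1 hv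
  have hab := mpLeft_lt_mpRight hy0 hv
  obtain ⟨i0, h0⟩ := integral_sqrt_mul_div hab (t := 0) (by simpa using ha)
  obtain ⟨it, h1⟩ := integral_sqrt_mul_div hab (t := t) (by linarith)
  have hcongr : ∫ x in (mpLeft y v)..(mpRight y v),
        1 / (x + t) * (√((mpRight y v - x) * (x - mpLeft y v)) / (x + 0)) =
      ∫ x in (mpLeft y v)..(mpRight y v),
        1 / t * (√((mpRight y v - x) * (x - mpLeft y v)) / (x + 0) -
          √((mpRight y v - x) * (x - mpLeft y v)) / (x + t)) := by
    refine intervalIntegral.integral_congr fun x hx => ?_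
    rw [Set.uIcc_of_le hab.le] at hx
    have hx0 : 0 < x := ha.trans_le hx.1
    simp only [add_zero]
    field_simp
    ring
  rw [hcongr, intervalIntegral.integral_const_mul, intervalIntegral.integral_sub i0 it, h0, h1,
    mpLeft_add_mpRight hy0.le, add_zero, add_zero, add_zero,
    mpLeft_mul_mpRight hy0.le, Real.sqrt_sq (by nlinarith)]
  have := Real.pi_pos
  field_simp
  ring

/-- The self-consistent equation of the Marčenko–Pastur law with variance parameter `1 / 2`. -/
theorem mpLaw_self_consistent {y : ℝ} (hy0 : 0 < y) (hy1 : y < 1) {t : ℝ} (ht : 0 < t) :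
    0 ≤ ∫ x, 1 / (x + t) ∂mpLaw y (1 / 2) ∧
    t * (∫ x, 1 / (x + t) ∂mpLaw y (1 / 2)) + (1 / 2) * (∫ x, 1 / (x + t) ∂mpLaw y (1 / 2)) /
      (1 + y / 2 * ∫ x, 1 / (x + t) ∂mpLaw y (1 / 2)) = 1 := by
  rw [integral_inv_add_mpLaw hy0 hy1 (by norm_num) ht]
  have hprod : (mpLeft y (1 / 2) + t) * (mpRight y (1 / 2) + t) =
      (t + 1 / 2 * (1 - y)) ^ 2 + 2 * y * t := by
    linear_combination mpLeft_mul_mpRight (v := 1 / 2) hy0.le +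
      t * mpLeft_add_mpRight (v := 1 / 2) hy0.le
  rw [hprod]
  set D := (t + 1 / 2 * (1 - y)) ^ 2 + 2 * y * t with hD
  have hDs : √D ^ 2 = D := Real.sq_sqrt (by positivity)
  have hlt : t + 1 / 2 * (1 - y) ≤ √D := Real.le_sqrt_of_sq_le (by rw [hD]; nlinarith)
  have hs : 0 ≤ (√D - t - 1 / 2 * (1 - y)) / (2 * y * (1 / 2) * t) :=
    div_nonneg (by linarith) (by positivity)
  refine ⟨hs, ?_⟩
  set s := (√D - t - 1 / 2 * (1 - y)) / (2 * y * (1 / 2) * t) with hsd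
  have hsq : √D = y * t * s + t + 1 / 2 * (1 - y) := by
    rw [hsd]; field_simp; ring
  rw [hsq, hD] at hDs
  have hy : y * t ≠ 0 := by positivity
  have hquad : t * y * s ^ 2 + (2 * t + 1 - y) * s - 2 = 0 := by
    apply mul_left_cancel₀ hy
    linear_combination hDs
  have : (1 + y / 2 * s) ≠ 0 := by positivity
  field_simp
  linear_combination hquad

end MarchenkoPastur

/-! ### The continuity theorem for Stieltjes transforms -/

section StieltjesConvergence

/-- The integrals of the test function `f` converge. Measurability of `f`, and a bound for it on the
half-line `x ≥ 0` that carries all the measures in use, are part of the notion. -/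
def IntegralsConverge (νs : ℕ → Measure ℝ) (ν : Measure ℝ) (f : ℝ → ℝ) : Prop :=
  Measurable f ∧ (∃ M, ∀ x, 0 ≤ x → |f x| ≤ M) ∧
    Tendsto (fun n => ∫ x, f x ∂νs n) atTop (𝓝 (∫ x, f x ∂ν))

theorem ae_nonneg_of_measure_Iio {ν : Measure ℝ} (hν : ν (Set.Iio 0) = 0) : ∀ᵐ x ∂ν, 0 ≤ x := by
  rw [ae_iff]
  exact measure_mono_null (fun x hx => not_le.1 hx) hν

theorem integrable_of_bounded_on_nonneg {ν : Measure ℝ} [IsProbabilityMeasure ν]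
    (hν : ν (Set.Iio 0) = 0) {f : ℝ → ℝ} (hf : Measurable f) {M : ℝ}
    (hM : ∀ x, 0 ≤ x → |f x| ≤ M) : Integrable f ν :=
  Integrable.of_bound hf.aestronglyMeasurable M ((ae_nonneg_of_measure_Iio hν).mono hM)

variable {νs : ℕ → Measure ℝ} {ν : Measure ℝ} [∀ n, IsProbabilityMeasure (νs n)]
  [IsProbabilityMeasure ν]

theorem IntegralsConverge.const (c : ℝ) : IntegralsConverge νs ν fun _ => c :=
  ⟨measurable_const, ⟨|c|, fun _ _ => le_rfl⟩, by simp⟩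

theorem IntegralsConverge.add (h0 : ∀ n, νs n (Set.Iio 0) = 0) (h0' : ν (Set.Iio 0) = 0)
    {f g : ℝ → ℝ} (hf : IntegralsConverge νs ν f) (hg : IntegralsConverge νs ν g) :
    IntegralsConverge νs ν fun x => f x + g x := by
  obtain ⟨fm, ⟨M, hM⟩, ft⟩ := hf
  obtain ⟨gm, ⟨M', hM'⟩, gt⟩ := hg
  refine ⟨fm.add gm, ⟨M + M', fun x hx => (abs_add_le _ _).trans (add_le_add (hM x hx) (hM' x hx))⟩,
    ?_⟩
  rw [integral_add (integrable_of_bounded_on_nonneg h0' fm hM)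
    (integrable_of_bounded_on_nonneg h0' gm hM')]
  refine (ft.add gt).congr fun n => ?_
  rw [integral_add (integrable_of_bounded_on_nonneg (h0 n) fm hM)
    (integrable_of_bounded_on_nonneg (h0 n) gm hM')]

omit [∀ n, IsProbabilityMeasure (νs n)] [IsProbabilityMeasure ν] in
theorem IntegralsConverge.const_mul {f : ℝ → ℝ} (hf : IntegralsConverge νs ν f) (c : ℝ) :
    IntegralsConverge νs ν fun x => c * f x := by
  obtain ⟨fm, ⟨M, hM⟩, ft⟩ := hf
  refine ⟨fm.const_mul c, ⟨|c| * M, fun x hx => ?_⟩, ?_⟩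
  · rw [abs_mul]; exact mul_le_mul_of_nonneg_left (hM x hx) (abs_nonneg _)
  · simp only [integral_const_mul]
    exact ft.const_mul c

theorem abs_integral_sub_le_of_nonneg {η : Measure ℝ} [IsProbabilityMeasure η]
    (h0 : η (Set.Iio 0) = 0) {f g : ℝ → ℝ} (hf : Integrable f η) (hg : Integrable g η) {ε : ℝ}
    (h : ∀ x, 0 ≤ x → |f x - g x| ≤ ε) : |∫ x, f x ∂η - ∫ x, g x ∂η| ≤ ε := by
  rw [← integral_sub hf hg]
  have := norm_integral_le_of_norm_le_const (μ := η) (f := fun x => f x - g x) (C := ε)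
    ((ae_nonneg_of_measure_Iio h0).mono fun x hx => h x hx)
  simpa using this

/-- The test functions whose integrals converge are closed under uniform limits. -/
theorem IntegralsConverge.of_approx (h0 : ∀ n, νs n (Set.Iio 0) = 0) (h0' : ν (Set.Iio 0) = 0)
    {f : ℝ → ℝ} (hf : Measurable f)
    (h : ∀ ε > 0, ∃ g, IntegralsConverge νs ν g ∧ ∀ x, 0 ≤ x → |f x - g x| ≤ ε) :
    IntegralsConverge νs ν f := by
  have hb : ∃ M, ∀ x, 0 ≤ x → |f x| ≤ M := by
    obtain ⟨g, ⟨-, ⟨M, hM⟩, -⟩, hg⟩ := h 1 one_pos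
    refine ⟨1 + M, fun x hx => ?_⟩
    calc |f x| = |(f x - g x) + g x| := by ring_nf
      _ ≤ _ := (abs_add_le _ _).trans (add_le_add (hg x hx) (hM x hx))
  refine ⟨hf, hb, ?_⟩
  obtain ⟨M, hM⟩ := hb
  rw [Metric.tendsto_atTop]
  intro ε hε
  obtain ⟨g, ⟨gm, ⟨M', hM'⟩, gt⟩, hg⟩ := h (ε / 3) (by positivity)
  obtain ⟨N, hN⟩ := Metric.tendsto_atTop.1 gt (ε / 3) (by positivity)
  refine ⟨N, fun n hn => ?_⟩
  have e1 := abs_integral_sub_le_of_nonneg (h0 n) (integrable_of_bounded_on_nonneg (h0 n) hf hM)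
    (integrable_of_bounded_on_nonneg (h0 n) gm hM') hg
  have e2 := abs_integral_sub_le_of_nonneg h0' (integrable_of_bounded_on_nonneg h0' hf hM)
    (integrable_of_bounded_on_nonneg h0' gm hM') hg
  have e3 := hN n hn
  rw [Real.dist_eq] at e3 ⊢
  rw [abs_le] at e1 e2
  rw [abs_lt] at e3 ⊢
  constructor <;> linarith

/-- From the Stieltjes transform at the points `-(1 + 1 / (m + 1))` to the functions
`(1 + x)⁻ᵏ`, by `(1 + x)⁻¹ - (1 + x + s)⁻¹ = s (1 + x)⁻¹ (1 + x + s)⁻¹`. -/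
theorem integralsConverge_inv_pow (h0 : ∀ n, νs n (Set.Iio 0) = 0) (h0' : ν (Set.Iio 0) = 0)
    (hS : ∀ m : ℕ, Tendsto (fun n => ∫ x, 1 / (x + (1 + 1 / ((m : ℝ) + 1))) ∂νs n) atTop
      (𝓝 (∫ x, 1 / (x + (1 + 1 / ((m : ℝ) + 1))) ∂ν))) (k : ℕ) :
    IntegralsConverge νs ν (fun x => (1 / (1 + x)) ^ k) ∧
    ∀ m : ℕ, IntegralsConverge νs ν
      (fun x => (1 / (1 + x)) ^ k * (1 / (x + (1 + 1 / ((m : ℝ) + 1))))) := by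
  have hs : ∀ m : ℕ, 0 < 1 / ((m : ℝ) + 1) := fun m => by positivity
  induction k with
  | zero =>
    refine ⟨by simpa using IntegralsConverge.const 1, fun m => ?_⟩
    simp only [pow_zero, one_mul]
    refine ⟨by fun_prop, ⟨1, fun x hx => ?_⟩, hS m⟩
    have := hs m
    rw [abs_of_pos (by positivity)]
    exact div_le_self zero_le_one (by linarith)
  | succ k ih =>
    have hk : IntegralsConverge νs ν (fun x => (1 / (1 + x)) ^ (k + 1)) := by
      refine IntegralsConverge.of_approx h0 h0' (by fun_prop) fun ε hε => ?_
      obtain ⟨m, hm⟩ := exists_nat_one_div_lt hε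
      refine ⟨_, ih.2 m, fun x hx => ?_⟩
      have hsm := hs m
      set s := 1 / ((m : ℝ) + 1)
      have e : (1 / (1 + x)) ^ (k + 1) - (1 / (1 + x)) ^ k * (1 / (x + (1 + s))) =
          (1 / (1 + x)) ^ (k + 1) * (1 / (x + (1 + s))) * s := by
        rw [pow_succ]
        have : 1 + x ≠ 0 := by positivity
        have : x + (1 + s) ≠ 0 := by positivity
        generalize (1 / (1 + x)) ^ k = c
        field_simp
        ring
      have e1 : (1 / (1 + x)) ^ (k + 1) ≤ 1 :=
        pow_le_one₀ (by positivity) (div_le_self zero_le_one (by linarith))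
      have e2 : 1 / (x + (1 + s)) ≤ 1 := div_le_self zero_le_one (by linarith)
      rw [e, abs_of_nonneg (by positivity)]
      calc _ ≤ 1 * 1 * s := by gcongr
        _ ≤ ε := by linarith
    refine ⟨hk, fun m => ?_⟩
    refine IntegralsConverge.of_approx h0 h0' (by fun_prop) fun ε hε => ?_
    refine ⟨_, (hk.add h0 h0' ((ih.2 m).const_mul (-1))).const_mul ((m : ℝ) + 1), fun x hx => ?_⟩
    rw [pow_succ]
    have h1 : 1 + x ≠ 0 := by positivity
    have h2 : x + (1 + 1 / ((m : ℝ) + 1)) ≠ 0 := by positivity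
    have h3 : (m : ℝ) + 1 ≠ 0 := by positivity
    refine le_of_eq_of_le ?_ hε.le
    rw [abs_eq_zero]
    generalize (1 / (1 + x)) ^ k = c
    have h4 : x * ((m : ℝ) + 1) + (m + 1 + 1) ≠ 0 := by positivity
    field_simp
    ring

/-- Stone–Weierstrass: the integrals of all continuous functions of `1 / (1 + x)` converge. -/
theorem integralsConverge_comp_inv (h0 : ∀ n, νs n (Set.Iio 0) = 0) (h0' : ν (Set.Iio 0) = 0)
    (hS : ∀ m : ℕ, Tendsto (fun n => ∫ x, 1 / (x + (1 + 1 / ((m : ℝ) + 1))) ∂νs n) atTop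
      (𝓝 (∫ x, 1 / (x + (1 + 1 / ((m : ℝ) + 1))) ∂ν))) {f : ℝ → ℝ} (hf : Continuous f) :
    IntegralsConverge νs ν (fun x => f (1 / (1 + x))) := by
  have hpoly : ∀ P : Polynomial ℝ, IntegralsConverge νs ν (fun x => P.eval (1 / (1 + x))) := by
    intro P
    induction P using Polynomial.induction_on' with
    | add P Q hP hQ => simpa only [Polynomial.eval_add] using hP.add h0 h0' hQ
    | monomial k c =>
      simpa only [Polynomial.eval_monomial] using
        (integralsConverge_inv_pow h0 h0' hS k).1.const_mul c
  refine IntegralsConverge.of_approx h0 h0' (hf.measurable.comp (by fun_prop)) fun ε hε => ?_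
  obtain ⟨P, hP⟩ := exists_polynomial_near_of_continuousOn 0 1 f hf.continuousOn ε hε
  refine ⟨_, hpoly P, fun x hx => ?_⟩
  rw [abs_sub_comm]
  exact (hP _ ⟨by positivity, div_le_self zero_le_one (by linarith)⟩).le

/-- Continuity theorem for Stieltjes transforms of probability measures on the half-line: pointwise
convergence on a sequence of points implies convergence of the distribution functions, when the
limit has no atoms. -/
theorem tendsto_measureReal_Iic_of_stieltjes [NullSingletonClass ν]
    (h0 : ∀ n, νs n (Set.Iio 0) = 0) (h0' : ν (Set.Iio 0) = 0)
    (hS : ∀ m : ℕ, Tendsto (fun n => ∫ x, 1 / (x + (1 + 1 / ((m : ℝ) + 1))) ∂νs n) atTop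
      (𝓝 (∫ x, 1 / (x + (1 + 1 / ((m : ℝ) + 1))) ∂ν))) (t : ℝ) :
    Tendsto (fun n => (νs n).real (Set.Iic t)) atTop (𝓝 (ν.real (Set.Iic t))) := by
  rcases lt_or_ge t 0 with ht | ht
  · have hz : ∀ η : Measure ℝ, η (Set.Iio 0) = 0 → η.real (Set.Iic t) = 0 := fun η hη => by
      rw [measureReal_def, measure_mono_null (Set.Iic_subset_Iio.2 ht) hη,
        ENNReal.toReal_zero]
    simp only [hz _ (h0 _), hz _ h0', tendsto_const_nhds]
  set w : ℝ → ℝ := fun x => 1 / (1 + x) with hw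
  have hwm : Measurable w := by fun_prop
  have hpr : ∀ η : Measure ℝ, IsProbabilityMeasure η → IsProbabilityMeasure (η.map w) :=
    fun η _ => Measure.isProbabilityMeasure_map hwm.aemeasurable
  set ηs : ℕ → ProbabilityMeasure ℝ := fun n => ⟨(νs n).map w, hpr _ inferInstance⟩ with hηs
  set η : ProbabilityMeasure ℝ := ⟨ν.map w, hpr _ inferInstance⟩ with hη
  have hweak : Tendsto ηs atTop (𝓝 η) := by
    rw [ProbabilityMeasure.tendsto_iff_forall_integral_tendsto]
    intro f
    have := (integralsConverge_comp_inv h0 h0' hS f.continuous).2.2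
    have e : ∀ ζ : Measure ℝ, ∫ x, f x ∂(ζ.map w) = ∫ x, f (1 / (1 + x)) ∂ζ := fun ζ =>
      integral_map hwm.aemeasurable f.continuous.measurable.aestronglyMeasurable
    simpa only [hηs, hη, ProbabilityMeasure.coe_mk, e] using this
  have hfr : (η : Measure ℝ) (frontier (Set.Ici (1 / (1 + t)))) = 0 := by
    rw [frontier_Ici]
    change (ν.map w) {1 / (1 + t)} = 0
    rw [Measure.map_apply hwm (measurableSet_singleton _)]
    refine measure_mono_null (t := {t}) (fun x hx => ?_) (measure_singleton t)
    have hx' : 1 / (1 + x) = 1 / (1 + t) := hx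
    rw [one_div, one_div, _root_.inv_inj] at hx'
    exact add_left_cancel hx'
  have hlim := ProbabilityMeasure.tendsto_measure_of_null_frontier_of_tendsto' hweak hfr
  have hset : ∀ ζ : Measure ℝ, ζ (Set.Iio 0) = 0 →
      (ζ.map w) (Set.Ici (1 / (1 + t))) = ζ (Set.Iic t) := fun ζ hζ => by
    rw [Measure.map_apply hwm measurableSet_Ici]
    refine measure_congr ((ae_nonneg_of_measure_Iio hζ).mono fun x hx => ?_)
    refine propext ?_
    change 1 / (1 + t) ≤ 1 / (1 + x) ↔ x ≤ t
    rw [one_div_le_one_div (by positivity) (by positivity)]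
    constructor <;> intro h <;> linarith
  have hlim' : Tendsto (fun n => νs n (Set.Iic t)) atTop (𝓝 (ν (Set.Iic t))) := by
    rw [← hset ν h0']
    exact hlim.congr fun n => hset _ (h0 n)
  exact (ENNReal.tendsto_toReal (measure_ne_top ν _)).comp hlim'

end StieltjesConvergence

/-! ### Empirical spectral distributions -/

section SpectralDistribution

/-- The uniform probability measure on the eigenvalues of a symmetric matrix. -/
noncomputable def spectralMeasure {p : ℕ} {A : Matrix (Fin p) (Fin p) ℝ} (hA : A.IsHermitian) :
    Measure ℝ :=
  ((p : ENNReal)⁻¹) • ∑ i, Measure.dirac (hA.eigenvalues i)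

variable {p : ℕ} {A : Matrix (Fin p) (Fin p) ℝ}

theorem isProbabilityMeasure_spectralMeasure (hA : A.IsHermitian) (hp : 0 < p) :
    IsProbabilityMeasure (spectralMeasure hA) := by
  constructor
  have : (p : ENNReal) ≠ 0 := by exact_mod_cast hp.ne'
  simp [spectralMeasure, ENNReal.inv_mul_cancel this (ENNReal.natCast_ne_top p)]

theorem esd_eq_spectralMeasure (hA : A.IsHermitian) (t : ℝ) :
    esd hA t = (spectralMeasure hA).real (Set.Iic t) := by
  rw [esd, measureReal_def, spectralMeasure, Measure.smul_apply, Measure.finsetSum_apply,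
    smul_eq_mul, ENNReal.toReal_mul, ENNReal.toReal_inv, ENNReal.toReal_natCast,
    ENNReal.toReal_sum (fun i _ => measure_ne_top _ _), one_div]
  congr 1
  refine Finset.sum_congr rfl fun i _ => ?_
  rw [Measure.dirac_apply' _ measurableSet_Iic, Set.indicator_apply]
  simp only [Set.mem_Iic]
  split_ifs <;> simp

theorem spectralMeasure_Iio (hA : A.PosSemidef) :
    spectralMeasure hA.isHermitian (Set.Iio 0) = 0 := by
  rw [spectralMeasure, Measure.smul_apply, Measure.finsetSum_apply, smul_eq_mul]
  refine mul_eq_zero_of_right _ (Finset.sum_eq_zero fun i _ => ?_)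
  rw [Measure.dirac_apply' _ measurableSet_Iio, Set.indicator_of_notMem]
  simpa using hA.eigenvalues_nonneg i

theorem integral_spectralMeasure (hA : A.IsHermitian) {f : ℝ → ℝ} :
    ∫ x, f x ∂spectralMeasure hA = (∑ i, f (hA.eigenvalues i)) / p := by
  rw [spectralMeasure, integral_smul_measure, integral_finsetSum_measure]
  · simp only [integral_dirac, ENNReal.toReal_inv, ENNReal.toReal_natCast, smul_eq_mul]
    rw [div_eq_inv_mul]
  · exact fun i _ => integrable_dirac (by simp)

/-- Convergence of the normalised traces of resolvents gives convergence of the empirical spectral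
distributions. -/
theorem convergesWeaklyTo_of_trace_regInv {p : ℕ → ℕ}
    {A : ∀ n, Matrix (Fin (p n)) (Fin (p n)) ℝ} (hA : ∀ n, (A n).PosSemidef)
    (hp : ∀ᶠ n in atTop, 0 < p n) {ν : Measure ℝ} [IsProbabilityMeasure ν] [NullSingletonClass ν]
    (h0 : ν (Set.Iio 0) = 0)
    (hS : ∀ m : ℕ, Tendsto (fun n => (regInv (A n) (1 + 1 / ((m : ℝ) + 1))).trace / p n) atTop
      (𝓝 (∫ x, 1 / (x + (1 + 1 / ((m : ℝ) + 1))) ∂ν))) :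
    ConvergesWeaklyTo (fun n => esd (hA n).isHermitian) ν := by
  intro t _
  obtain ⟨N, hN⟩ := eventually_atTop.1 hp
  rw [← tendsto_add_atTop_iff_nat N]
  simp only [esd_eq_spectralMeasure]
  have : ∀ n, IsProbabilityMeasure (spectralMeasure (hA (n + N)).isHermitian) := fun n =>
    isProbabilityMeasure_spectralMeasure _ (hN _ (by omega))
  refine tendsto_measureReal_Iic_of_stieltjes
    (νs := fun n => spectralMeasure (hA (n + N)).isHermitian)
    (fun n => spectralMeasure_Iio (hA _)) h0 (fun m => ?_) t
  refine ((tendsto_add_atTop_iff_nat N).2 (hS m)).congr fun n => ?_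
  rw [integral_spectralMeasure, trace_regInv_eq_sum_eigenvalues (hA _) (by positivity)]

end SpectralDistribution

/-! ### Law of the array and Borel–Cantelli -/

section AlmostSure

variable {Ω : Type*} [MeasurableSpace Ω] {μ : Measure Ω} [IsProbabilityMeasure μ]

/-- The observations form a sample from a product measure. -/
theorem map_array_eq_pi {X : ℕ → ℕ → Ω → ℝ} (hmeas : ∀ k i, Measurable (X k i))
    (hindep : iIndepFun (fun ki : ℕ × ℕ => X ki.1 ki.2) μ)
    (hident : ∀ k i, IdentDistrib (X k i) (X 0 0) μ μ) (p n : ℕ) :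
    μ.map (fun ω (i : Fin n) (k : Fin p) => X k i ω) =
      Measure.pi fun _ => Measure.pi fun _ => μ.map (X 0 0) := by
  have : IsProbabilityMeasure (μ.map (X 0 0)) :=
    Measure.isProbabilityMeasure_map (hmeas 0 0).aemeasurable
  have hinj : Function.Injective fun z : Fin n × Fin p => ((z.2 : ℕ), (z.1 : ℕ)) := by
    rintro ⟨a, b⟩ ⟨c, d⟩ h
    simp only [Prod.mk.injEq] at h
    exact Prod.ext (Fin.ext h.2) (Fin.ext h.1)
  have h1 := (hindep.precomp hinj).map_fun_eq_pi_map
    (fun z : Fin n × Fin p => (hmeas (z.2 : ℕ) (z.1 : ℕ)).aemeasurable)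
  simp only [(hident _ _).map_eq] at h1
  have h2 := Measure.infinitePi_map_curry (fun (_ : Fin n) (_ : Fin p) => μ.map (X 0 0))
  simp only [Measure.infinitePi_eq_pi] at h2
  rw [← h2, ← h1, Measure.map_map (by fun_prop)
    (measurable_pi_lambda _ fun z => hmeas _ _)]
  rfl

/-- Borel–Cantelli for exponentially small tails. -/
theorem ae_tendsto_of_exponential_tails {Y : ℕ → Ω → ℝ} {m : ℕ → ℝ} {good : ℕ → Prop}
    (hgood : ∀ᶠ n in atTop, good n)
    (h : ∀ ε > 0, ∃ κ > 0, ∀ n, good n →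
      μ.real {ω | ε ≤ |Y n ω - m n|} ≤ 2 * Real.exp (-κ * n)) :
    ∀ᵐ ω ∂μ, Tendsto (fun n => Y n ω - m n) atTop (𝓝 0) := by
  have hev : ∀ j : ℕ, ∀ᵐ ω ∂μ, ∀ᶠ n in atTop, |Y n ω - m n| < 1 / ((j : ℝ) + 1) := fun j => by
    obtain ⟨κ, hκ, hb⟩ := h (1 / ((j : ℝ) + 1)) (by positivity)
    have hsum : Summable fun n : ℕ => 2 * Real.exp (-κ * n) := by
      refine Summable.mul_left _ ?_
      have := Real.summable_exp_nat_mul_iff.2 (neg_neg_of_pos hκ)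
      exact this.congr fun n => by rw [mul_comm]
    set s : ℕ → Set Ω := fun n => {ω | good n ∧ 1 / ((j : ℝ) + 1) ≤ |Y n ω - m n|} with hs
    have hle : ∀ n, μ (s n) ≤ ENNReal.ofReal (2 * Real.exp (-κ * n)) := fun n => by
      by_cases hg : good n
      · have hsub : s n ⊆ {ω | 1 / ((j : ℝ) + 1) ≤ |Y n ω - m n|} := fun ω hω => hω.2
        refine (measure_mono hsub).trans ?_
        rw [← ofReal_measureReal (measure_ne_top μ _)]
        exact ENNReal.ofReal_le_ofReal (hb n hg)
      · have : s n = ∅ := by ext ω; simp [hs, hg]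
        rw [this, measure_empty]
        exact zero_le
    have hne : ∑' n, μ (s n) ≠ ⊤ := by
      refine ne_top_of_le_ne_top ?_ (ENNReal.tsum_le_tsum hle)
      exact hsum.tsum_ofReal_ne_top
    filter_upwards [ae_eventually_notMem hne] with ω hω
    filter_upwards [hω, hgood] with n hn hg
    by_contra hcon
    exact hn ⟨hg, not_lt.1 hcon⟩
  filter_upwards [ae_all_iff.2 hev] with ω hω
  rw [Metric.tendsto_nhds]
  intro ε hε
  obtain ⟨j, hj⟩ := exists_nat_one_div_lt hε
  filter_upwards [hω j] with n hn
  rw [Real.dist_eq, sub_zero]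
  exact hn.trans hj

end AlmostSure

/-! ### Almost sure convergence of the spectral distribution -/

section Limit

theorem eventually_pos_of_tendsto_div {y : ℝ} (hy0 : 0 < y) {p : ℕ → ℕ}
    (hp : Tendsto (fun n : ℕ => (p n : ℝ) / (n : ℝ)) atTop (𝓝 y)) : ∀ᶠ n in atTop, 0 < p n := by
  filter_upwards [hp (lt_mem_nhds hy0)] with n hn
  refine Nat.pos_of_ne_zero fun h => ?_
  have hn' : (0 : ℝ) < (p n : ℝ) / n := hn
  simp [h] at hn'

/-- The error bound for the mean Stieltjes transform of `½ p K_n` vanishes in the limit. -/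
theorem tendsto_kendall_error {y : ℝ} (hy0 : 0 < y) {p : ℕ → ℕ}
    (hp : Tendsto (fun n : ℕ => (p n : ℝ) / (n : ℝ)) atTop (𝓝 y)) (C t : ℝ) :
    Tendsto (fun n : ℕ => ((√(C * p n) + √(p n)) / t ^ 2 + 1 / t) / p n +
      ((1 / (2 * ((n : ℝ) - 1)) * n) / p n * (√(C * p n) / t + 1 / t) +
        |1 / (2 * ((n : ℝ) - 1)) * n - 1 / 2| / t +
        1 / 2 * |1 / (2 * ((n : ℝ) - 1)) * p n - y / 2| / t ^ 2) / t) atTop (𝓝 0) := by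
  have hpinf : Tendsto (fun n => (p n : ℝ)) atTop atTop := by
    refine (hp.pos_mul_atTop hy0 tendsto_natCast_atTop_atTop).congr' ?_
    filter_upwards [eventually_gt_atTop 0] with n hn
    have : (n : ℝ) ≠ 0 := by exact_mod_cast hn.ne'
    field_simp
  have hq : Tendsto (fun n => 1 / (p n : ℝ)) atTop (𝓝 0) := by
    simpa only [one_div, Function.comp_def] using tendsto_inv_atTop_zero.comp hpinf
  have hr : Tendsto (fun n => √(p n : ℝ) / p n) atTop (𝓝 0) := by
    have h := tendsto_inv_atTop_zero.comp (Real.tendsto_sqrt_atTop.comp hpinf)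
    refine h.congr fun n => ?_
    simp only [Function.comp_apply, Real.sqrt_div_self', one_div]
  have ha : Tendsto (fun n : ℕ => 1 / (2 * ((n : ℝ) - 1)) * n) atTop (𝓝 (1 / 2)) := by
    have h1 : Tendsto (fun n : ℕ => (1 / 2 : ℝ) * (1 - 1 / (n : ℝ))⁻¹) atTop
        (𝓝 (1 / 2 * (1 - 0)⁻¹)) :=
      ((tendsto_const_nhds.sub tendsto_one_div_atTop_nhds_zero_nat).inv₀ (by norm_num)).const_mul _
    simp only [sub_zero, inv_one, mul_one] at h1
    refine h1.congr' ?_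
    filter_upwards [eventually_gt_atTop 1] with n hn
    have e1 : (1 : ℝ) < n := by exact_mod_cast hn
    have e2 : (n : ℝ) - 1 ≠ 0 := by linarith
    have e3 : (n : ℝ) ≠ 0 := by linarith
    field_simp
  have hb : Tendsto (fun n : ℕ => 1 / (2 * ((n : ℝ) - 1)) * p n) atTop (𝓝 (y / 2)) := by
    have h := ha.mul hp
    rw [one_div_mul_eq_div] at h
    refine h.congr' ?_
    filter_upwards [eventually_gt_atTop 0] with n hn
    have e3 : (n : ℝ) ≠ 0 := by exact_mod_cast hn.ne'
    field_simp
  set Φ : ℝ × ℝ × ℝ × ℝ → ℝ := fun z =>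
    (√C * z.1 + z.1) / t ^ 2 + z.2.1 / t + (z.2.2.1 * (√C * z.1 / t + z.2.1 / t) +
      |z.2.2.1 - 1 / 2| / t + 1 / 2 * |z.2.2.2 - y / 2| / t ^ 2) / t with hΦ
  have hΦc : Continuous Φ := by
    rw [hΦ]
    simp only [div_eq_mul_inv]
    fun_prop
  have h := (hΦc.tendsto (0, 0, 1 / 2, y / 2)).comp
    (hr.prodMk_nhds (hq.prodMk_nhds (ha.prodMk_nhds hb)))
  have hz : Φ (0, 0, 1 / 2, y / 2) = 0 := by simp [hΦ]
  rw [hz] at h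
  refine h.congr fun n => ?_
  simp only [hΦ, Function.comp_apply]
  rw [Real.sqrt_mul' C (Nat.cast_nonneg _)]
  simp only [div_eq_mul_inv]
  ring

variable {Ω : Type*} [MeasurableSpace Ω] {μ : Measure Ω} [IsProbabilityMeasure μ]

theorem scaledKendallTau_posSemidef {p n : ℕ} (x : Fin n → EuclideanSpace ℝ (Fin p)) :
    (scaledKendallTau x).PosSemidef := by
  have h := scaledKendallTau_eq_pairSum fun i => (x i).ofLp
  simp only [WithLp.toLp_ofLp] at h
  rw [h]
  exact pairSum_posSemidef _ (kendallWeight_nonneg _) _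

/-- Almost sure convergence of the Stieltjes transform of `½ p K_n` at a point `-t < 0`. -/
theorem ae_tendsto_trace_kendall {X : ℕ → ℕ → Ω → ℝ} (hmeas : ∀ k i, Measurable (X k i))
    (hindep : iIndepFun (fun ki : ℕ × ℕ => X ki.1 ki.2) μ)
    (hident : ∀ k i, IdentDistrib (X k i) (X 0 0) μ μ) (hfourth : MemLp (X 0 0) 4 μ)
    (hmean : ∫ ω, X 0 0 ω ∂μ = 0) (hvar : variance (X 0 0) μ = 1) {y : ℝ} (hy0 : 0 < y)
    (hy1 : y < 1) {p : ℕ → ℕ} (hp : Tendsto (fun n : ℕ => (p n : ℝ) / (n : ℝ)) atTop (𝓝 y))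
    {t : ℝ} (ht : 0 < t) :
    ∀ᵐ ω ∂μ, Tendsto (fun n =>
      (regInv (scaledKendallTau (observations X (p n) n ω)) t).trace / p n) atTop
      (𝓝 (∫ x, 1 / (x + t) ∂mpLaw y (1 / 2))) := by
  set ρ := μ.map (X 0 0) with hρ
  have hX := (hmeas 0 0).aemeasurable (μ := μ)
  have : IsProbabilityMeasure ρ := Measure.isProbabilityMeasure_map hX
  have h4 : MemLp id 4 ρ := (memLp_map_measure_iff aestronglyMeasurable_id hX).2 hfourth
  have h1 : ∫ x, x ∂ρ = 0 := by
    rw [hρ, integral_map hX (by fun_prop)]; exact hmean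
  have h2 : ∫ x, x ^ 2 ∂ρ = 1 := by
    rw [hρ, integral_map hX (by fun_prop), ← hvar, variance_of_integral_eq_zero hX hmean]
  have hy2 : 0 ≤ y / 2 := by linarith
  obtain ⟨hs0, hroot⟩ := mpLaw_self_consistent hy0 hy1 ht
  set s₀ := ∫ x, 1 / (x + t) ∂mpLaw y (1 / 2)
  set f : ∀ n, (Fin n → Fin (p n) → ℝ) → ℝ := fun n x =>
    (regInv (pairSum (pairs n) (kendallWeight x) x) t).trace / p n with hf
  have hfm : ∀ n, Measurable (f n) := fun n =>
    (measurable_trace_regInv measurable_kendall_apply t).div_const _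
  set P : ∀ n, Measure (Fin n → Fin (p n) → ℝ) := fun n =>
    Measure.pi fun _ => Measure.pi fun _ => ρ with hP
  set obs : ∀ n, Ω → Fin n → Fin (p n) → ℝ := fun n ω i k => X k i ω with hobs
  have hobsm : ∀ n, Measurable (obs n) := fun n =>
    measurable_pi_lambda _ fun i => measurable_pi_lambda _ fun k => hmeas _ _
  have hmap : ∀ n, μ.map (obs n) = P n := fun n => map_array_eq_pi hmeas hindep hident (p n) n
  have hfM : ∀ n, ∀ x, |f n x| ≤ p n / t / p n := fun n x => by
    have hK := pairSum_posSemidef (pairs n) (kendallWeight_nonneg x) x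
    have hT := trace_regInv_le hK ht
    rw [Fintype.card_fin] at hT
    rw [abs_of_nonneg (div_nonneg (trace_regInv_nonneg hK ht) (Nat.cast_nonneg _))]
    exact div_le_div_of_nonneg_right hT (Nat.cast_nonneg _)
  have hppos := eventually_pos_of_tendsto_div hy0 hp
  have hgood : ∀ᶠ n in atTop, 2 ≤ n ∧ 0 < p n := (eventually_ge_atTop 2).and hppos
  -- concentration around the mean
  have hconc : ∀ᵐ ω ∂μ, Tendsto (fun n => f n (obs n ω) - ∫ x, f n x ∂P n) atTop (𝓝 0) := by
    refine ae_tendsto_of_exponential_tails hgood fun ε hε => ?_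
    refine ⟨t ^ 4 * ε ^ 2 / 128, by positivity, fun n hn => ?_⟩
    have hn0 : (0 : ℝ) < n := by exact_mod_cast (by omega : 0 < n)
    -- `l = n t⁴ ε / 64` minimises the exponent `32 l² / (n t⁴) - l ε`
    have htail := measure_abs_sub_integral_ge_le (Measure.pi fun _ : Fin (p n) => ρ)
      (c := 8 / (n * t ^ 2)) (by positivity) (hfm n) ⟨_, hfM n⟩
      (fun x i e => kendall_bounded_difference hn.2 hn.1 ht x i e) (ε := ε)
      (l := n * t ^ 4 * ε / 64) (by positivity)
    have hset : μ.real {ω | ε ≤ |f n (obs n ω) - ∫ x, f n x ∂P n|} =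
        (P n).real {x | ε ≤ |f n x - ∫ x', f n x' ∂P n|} := by
      rw [← hmap n, map_measureReal_apply (hobsm n)]
      · rfl
      · exact measurableSet_le measurable_const ((hfm n).sub_const _).abs
    rw [hset]
    refine htail.trans (le_of_eq ?_)
    congr 2
    field_simp
    ring
  -- convergence of the mean
  have hmeanlim : Tendsto (fun n => ∫ x, f n x ∂P n) atTop (𝓝 s₀) := by
    rw [tendsto_iff_dist_tendsto_zero]
    refine squeeze_zero' (Eventually.of_forall fun n => dist_nonneg) ?_
      (tendsto_kendall_error hy0 hp (2 * ∫ x, x ^ 4 ∂ρ + 4) t)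
    filter_upwards [hgood] with n hn
    have hfi : Integrable (f n) (P n) := integrable_of_abs_le (hfm n) (hfM n)
    rw [Real.dist_eq]
    refine le_trans ?_ (integral_abs_trace_kendall_sub_le h4 h1 h2 hn.2 hn.1 ht hy2 hs0 hroot)
    have e : ∫ x, f n x ∂P n - s₀ = ∫ x, (f n x - s₀) ∂P n := by
      rw [integral_sub hfi (integrable_const _)]; simp
    rw [e]
    exact abs_integral_le_integral_abs
  filter_upwards [hconc] with ω hω
  have h := hω.add hmeanlim
  simp only [sub_add_cancel, zero_add] at h
  refine h.congr fun n => ?_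
  rw [hf]
  simp only
  rw [← scaledKendallTau_eq_pairSum]
  rfl

end Limit

theorem theorem2p1 {Ω : Type*} [MeasurableSpace Ω] (μ : Measure Ω) [IsProbabilityMeasure μ]
    (X : ℕ → ℕ → Ω → ℝ)
    (hmeas : ∀ k i, Measurable (X k i))
    (hindep : iIndepFun (fun ki : ℕ × ℕ => X ki.1 ki.2) μ)
    (hident : ∀ k i, IdentDistrib (X k i) (X 0 0) μ μ)
    (hfourth : MemLp (X 0 0) 4 μ)
    (hmean : ∫ ω, X 0 0 ω ∂μ = 0)
    (hvar : variance (X 0 0) μ = 1)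
    (y : ℝ) (hy0 : 0 < y) (hy1 : y < 1)
    (p : ℕ → ℕ) (hp : Tendsto (fun n : ℕ => (p n : ℝ) / (n : ℝ)) atTop (𝓝 y)) :
    IsProbabilityMeasure (mpLaw y (1 / 2)) ∧
    mpLaw y (1 / 2)
      (Set.Icc ((1 / 2) * (1 - Real.sqrt y) ^ 2) ((1 / 2) * (1 + Real.sqrt y) ^ 2))ᶜ = 0 ∧
    ∀ᵐ ω ∂μ, ConvergesWeaklyTo
      (fun n => esd (scaledKendallTau_isHermitian (observations X (p n) n ω)))
      (mpLaw y (1 / 2)) := by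
  have hprob := isProbabilityMeasure_mpLaw hy0 hy1 (by norm_num : (0 : ℝ) < 1 / 2)
  have hsupp := mpLaw_compl_Icc y (1 / 2)
  refine ⟨hprob, hsupp, ?_⟩
  have hatoms : NullSingletonClass (mpLaw y (1 / 2)) :=
    ⟨fun x => withDensity_absolutelyContinuous _ _ (measure_singleton x)⟩
  have hneg : mpLaw y (1 / 2) (Set.Iio 0) = 0 := by
    refine measure_mono_null (fun x (hx : x < 0) => ?_) hsupp
    intro hx'
    exact (hx.trans (mpLeft_pos hy1 (by norm_num))).not_ge hx'.1
  have hppos := eventually_pos_of_tendsto_div hy0 hp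
  have hS : ∀ᵐ ω ∂μ, ∀ m : ℕ, Tendsto (fun n =>
      (regInv (scaledKendallTau (observations X (p n) n ω)) (1 + 1 / ((m : ℝ) + 1))).trace / p n)
      atTop (𝓝 (∫ x, 1 / (x + (1 + 1 / ((m : ℝ) + 1))) ∂mpLaw y (1 / 2))) :=
    ae_all_iff.2 fun m => ae_tendsto_trace_kendall hmeas hindep hident hfourth hmean hvar hy0 hy1
      hp (by positivity)
  filter_upwards [hS] with ω hω
  exact convergesWeaklyTo_of_trace_regInv (fun n => scaledKendallTau_posSemidef _) hppos hneg hω
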